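/- Let $A\in\mathbb{R}^{n\times n}$, $0\ne\mathbf{v}\in\mathbb{R}^n$, $\beta=\|\mathbf{v}\|_2$. For square matrices $M$ put $\varphi_0(M)=\exp(M)$ and $\varphi_\ell(M)=\frac{1}{(\ell-1)!}\int_0^1 e^{(1-\theta)M}\theta^{\ell-1}\,d\theta$ for $\ell\ge 1$. Assume that the numerical range $W(A)=\{(A\mathbf{x},\mathbf{x})/(\mathbf{x},\mathbf{x}):\mathbf{0}\ne\mathbf{x}\in\mathbb{C}^n\}$ is contained in $\Sigma_{\vartheta,a}=\{z\in\mathbb{C}:|\arg(z-a)|\le\vartheta\}$ (with $\arg 0=0$), where $a\ge 0$ and $0\le\vartheta\le\pi/2$. Let $k\ge1$. The Arnoldi process sets $\mathbf{v}_1=\mathbf{v}/\beta$, $h_{i,j}=\mathbf{v}_i^{\rm T}A\mathbf{v}_j$ for $i\le j$, $\mathbf{w}_j=A\mathbf{v}_j-\sum_{i\le j}h_{i,j}\mathbf{v}_i$, $h_{j+1,j}=\|\mathbf{w}_j\|_2$, $\mathbf{v}_{j+1}=\mathbf{w}_j/h_{j+1,j}$, and $h_{i,j}=0$ for $i>j+1$.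 Assume that it does not break down before step $k$, i.e. $h_{j+1,j}\neq0$ for $1\le j\le k-1$. Let $V_k=[\mathbf{v}_1,\dots,\mathbf{v}_k]$ and $H_k=(h_{i,j})_{i,j=1}^k$, and let $\mathbf{e}_1,\mathbf{e}_k$ be the first and the last column of the $k\times k$ identity matrix. For an integer $\ell\ge0$ and $t>0$ let $$\mathbf{y}(t)=\varphi_\ell(-tA)\mathbf{v},\qquad \mathbf{y}_{\ell,k}(t)=V_k\varphi_\ell(-tH_k)\beta\mathbf{e}_1,\qquad \mathbf{e}_{\ell,k}(t)=\mathbf{y}(t)-\mathbf{y}_{\ell,k}(t)$$ be the exact vector, its Arnoldi approximation, and the error. Let $\mathbf{r}_{\ell,k}(t)$ be the residual, i.e. $\mathbf{r}_{0,k}(t)=-A\mathbf{y}_{0,k}(t)-\mathbf{y}_{0,k}'(t)$ and $$\mathbf{r}_{\ell,k}(t)=-A\mathbf{y}_{\ell,k}(t)-\frac{\ell}{t}\mathbf{y}_{\ell,k}(t)+\frac{1}{t(\ell-1)!}\mathbf{v}-\mathbf{y}_{\ell,k}'(t)\qquad(\ell\ge1).$$ Assume that $\mathbf{e}_k^{\rm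 T}\varphi_\ell(-tH_k)\mathbf{e}_1\ne0$. Let $\mu_j=a_j+\mathbf{i}b_j$ ($1\le j\le k$) be the eigenvalues of $H_k$, counted with algebraic multiplicity and ordered so that $\mu_1,\dots,\mu_{k_1}$ are the real ones and $\mu_{k_1+1},\dots,\mu_k$ the non-real ones. Let $\varepsilon>0$, $r_j=\big((\varepsilon+a_j)^2+b_j^2\big)^{1/2}$, and $$\omega_k(\varepsilon)=\prod_{j=1}^k\big(r_j(\varepsilon+a_j)\big)^{1/2},\qquad \varsigma_k(\rho)=\prod_{j=1}^{k_1}\Big(1+\frac{\rho^2}{r_j^2}\Big)^{1/2}\prod_{j=k_1+1}^{k}\Big(1+\frac{\rho^2}{r_j^2}\Big)^{1/4}.$$ **Theorem.** If $k+k_1+2\ell\ge4$, then the integral below converges and $$\|\mathbf{e}_{\ell,k}(t)\|_2\le c_{\ell,k}\cdot\int_0^\infty\frac{(1+\rho^2/\varepsilon^2)^{-\ell/2}}{\varsigma_k(\rho)}\,d\rho\cdot\|\mathbf{r}_{\ell,k}(t)\|_2,$$ where $$c_{\ell,k}=\frac{\exp(t\varepsilon)}{\pi(t\varepsilon)^\ell\,\omega_k(\varepsilon)(\varepsilon+a)}\cdot\frac{\prod_{j=1}^{k-1}h_{j+1,j}}{\big|\mathbf{e}_k^{\rm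 T}\varphi_\ell(-tH_k)\mathbf{e}_1\big|}.$$ -/

import Mathlib

open MeasureTheory

namespace ArnoldiPhi

noncomputable section

/-- The matrix functions `φ_ℓ`: `φ₀(M) = exp M`, and for `ℓ ≥ 1`
`φ_ℓ(M) = 1/(ℓ-1)! ∫₀¹ exp((1-θ)M) θ^(ℓ-1) dθ`, the integral being taken entrywise. -/
def phi {m : ℕ} : ℕ → Matrix (Fin m) (Fin m) ℝ → Matrix (Fin m) (Fin m) ℝ
  | 0, M => NormedSpace.exp M
  | ℓ + 1, M => Matrix.of fun i j =>
      1 / (ℓ.factorial : ℝ) * ∫ θ in (0 : ℝ)..1, (NormedSpace.exp ((1 - θ) • M)) i j * θ ^ ℓ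

/-- The numerical range (over complex vectors) of a real square matrix. -/
def numericalRange {n : ℕ} (A : Matrix (Fin n) (Fin n) ℝ) : Set ℂ :=
  {z | ∃ x : EuclideanSpace ℂ (Fin n), x ≠ 0 ∧
    z = inner ℂ x (Matrix.toEuclideanLin (A.map (fun s : ℝ => (s : ℂ))) x) / inner ℂ x x}

/-- The sector `Σ_{ϑ,a}` with apex `a` and half-angle `ϑ` (the apex belongs to it for `0 ≤ ϑ`,
since `arg 0 = 0`). -/
def sector (ϑ a : ℝ) : Set ℂ :=
  {z | |Complex.arg (z - (a : ℂ))| ≤ ϑ}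

/-- The vectors of the Arnoldi process, numbered from `0`: the starting vector is `v / ‖v‖`, and
the vector number `j + 1` is the normalization of
`A vⱼ - ∑_{i ≤ j} ⟨vᵢ, A vⱼ⟩ vᵢ`. -/
def arnoldiVec {n : ℕ} (A : Matrix (Fin n) (Fin n) ℝ) (v : EuclideanSpace ℝ (Fin n)) :
    ℕ → EuclideanSpace ℝ (Fin n)
  | 0 => ‖v‖⁻¹ • v
  | j + 1 =>
      let u : EuclideanSpace ℝ (Fin n) := Matrix.toEuclideanLin A (arnoldiVec A v j)
      let w : EuclideanSpace ℝ (Fin n) :=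
        u - ∑ i : Fin (j + 1), (inner ℝ (arnoldiVec A v i.1) u : ℝ) • arnoldiVec A v i.1
      ‖w‖⁻¹ • w
  termination_by j => j
  decreasing_by all_goals omega

/-- The unnormalized vector `A vⱼ - ∑_{i ≤ j} ⟨vᵢ, A vⱼ⟩ vᵢ` of the Arnoldi process. -/
def arnoldiNext {n : ℕ} (A : Matrix (Fin n) (Fin n) ℝ) (v : EuclideanSpace ℝ (Fin n)) (j : ℕ) :
    EuclideanSpace ℝ (Fin n) :=
  Matrix.toEuclideanLin A (arnoldiVec A v j) -
    ∑ i : Fin (j + 1),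
      (inner ℝ (arnoldiVec A v i.1) (Matrix.toEuclideanLin A (arnoldiVec A v j)) : ℝ) •
        arnoldiVec A v i.1

theorem arnoldiVec_zero {n : ℕ} (A : Matrix (Fin n) (Fin n) ℝ) (v : EuclideanSpace ℝ (Fin n)) :
    arnoldiVec A v 0 = ‖v‖⁻¹ • v := by
  rw [arnoldiVec]

theorem arnoldiVec_succ {n : ℕ} (A : Matrix (Fin n) (Fin n) ℝ) (v : EuclideanSpace ℝ (Fin n))
    (j : ℕ) : arnoldiVec A v (j + 1) = ‖arnoldiNext A v j‖⁻¹ • arnoldiNext A v j := by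
  rw [arnoldiVec]
  rfl

/-- The Arnoldi coefficients `h_{i,j}` (indices from `0`): `⟨vᵢ, A vⱼ⟩` for `i ≤ j`,
the norm of the unnormalized next vector for `i = j + 1`, and `0` below the subdiagonal. -/
def arnoldiCoeff {n : ℕ} (A : Matrix (Fin n) (Fin n) ℝ) (v : EuclideanSpace ℝ (Fin n))
    (i j : ℕ) : ℝ :=
  if i ≤ j then inner ℝ (arnoldiVec A v i) (Matrix.toEuclideanLin A (arnoldiVec A v j))
  else if i = j + 1 then ‖arnoldiNext A v j‖
  else 0

/-- The `k × k` upper Hessenberg matrix `H_k` of the Arnoldi process. -/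
def hessenberg {n : ℕ} (A : Matrix (Fin n) (Fin n) ℝ) (v : EuclideanSpace ℝ (Fin n)) (k : ℕ) :
    Matrix (Fin k) (Fin k) ℝ :=
  Matrix.of fun i j => arnoldiCoeff A v i.1 j.1

/-- The exact vector `y(t) = φ_ℓ(-tA) v`. -/
def exactSol {n : ℕ} (A : Matrix (Fin n) (Fin n) ℝ) (v : EuclideanSpace ℝ (Fin n)) (ℓ : ℕ)
    (t : ℝ) : EuclideanSpace ℝ (Fin n) :=
  Matrix.toEuclideanLin (phi ℓ ((-t) • A)) v

/-- The Arnoldi approximation `y_{ℓ,k}(t) = V_k φ_ℓ(-t H_k) β e₁`, with `β = ‖v‖`. -/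
def arnoldiApprox {n : ℕ} (A : Matrix (Fin n) (Fin n) ℝ) (v : EuclideanSpace ℝ (Fin n)) (ℓ : ℕ)
    {k : ℕ} (hk : 1 ≤ k) (t : ℝ) : EuclideanSpace ℝ (Fin n) :=
  ∑ j : Fin k,
    Matrix.mulVec (phi ℓ ((-t) • hessenberg A v k)) (Pi.single (⟨0, hk⟩ : Fin k) ‖v‖) j •
      arnoldiVec A v j.1

/-- The error `e_{ℓ,k}(t) = y(t) - y_{ℓ,k}(t)`. -/
def arnoldiError {n : ℕ} (A : Matrix (Fin n) (Fin n) ℝ) (v : EuclideanSpace ℝ (Fin n)) (ℓ : ℕ)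
    {k : ℕ} (hk : 1 ≤ k) (t : ℝ) : EuclideanSpace ℝ (Fin n) :=
  exactSol A v ℓ t - arnoldiApprox A v ℓ hk t

/-- The residual: `r_{0,k}(t) = -A y_{0,k}(t) - y_{0,k}'(t)`, and for `ℓ ≥ 1`
`r_{ℓ,k}(t) = -A y_{ℓ,k}(t) - (ℓ/t) y_{ℓ,k}(t) + v / (t (ℓ-1)!) - y_{ℓ,k}'(t)`. -/
def arnoldiResidual {n : ℕ} (A : Matrix (Fin n) (Fin n) ℝ) (v : EuclideanSpace ℝ (Fin n)) :
    ℕ → {k : ℕ} → 1 ≤ k → ℝ → EuclideanSpace ℝ (Fin n)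
  | 0, _, hk, t =>
      -Matrix.toEuclideanLin A (arnoldiApprox A v 0 hk t)
        - deriv (fun s : ℝ => arnoldiApprox A v 0 hk s) t
  | ℓ + 1, _, hk, t =>
      -Matrix.toEuclideanLin A (arnoldiApprox A v (ℓ + 1) hk t)
        - (((ℓ + 1 : ℕ) : ℝ) / t) • arnoldiApprox A v (ℓ + 1) hk t
        + (1 / (t * (ℓ.factorial : ℝ))) • v
        - deriv (fun s : ℝ => arnoldiApprox A v (ℓ + 1) hk s) t

/-- The complex eigenvalues of a real matrix, with algebraic multiplicity. -/
def eigs {k : ℕ} (H : Matrix (Fin k) (Fin k) ℝ) : Multiset ℂ :=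
  (H.map (fun s : ℝ => (s : ℂ))).charpoly.roots

/-- The number `k₁` of real eigenvalues, with algebraic multiplicity. -/
def realEigCount {k : ℕ} (H : Matrix (Fin k) (Fin k) ℝ) : ℕ :=
  (eigs H).countP (fun μ => μ.im = 0)

/-- `r = ((ε + a)² + b²)^(1/2)` for the eigenvalue `μ = a + i b`. -/
def radius (ε : ℝ) (μ : ℂ) : ℝ :=
  Real.sqrt ((ε + μ.re) ^ 2 + μ.im ^ 2)

/-- `ω_k(ε) = ∏ (r_j (ε + a_j))^(1/2)` over the eigenvalues. -/
def omega {k : ℕ} (H : Matrix (Fin k) (Fin k) ℝ) (ε : ℝ) : ℝ :=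
  ((eigs H).map fun μ => Real.sqrt (radius ε μ * (ε + μ.re))).prod

/-- `ς_k(ρ)`: the product of `(1 + ρ²/r_j²)^(1/2)` over the real eigenvalues and of
`(1 + ρ²/r_j²)^(1/4)` over the non-real ones. -/
def varsigma {k : ℕ} (H : Matrix (Fin k) (Fin k) ℝ) (ε ρ : ℝ) : ℝ :=
  ((eigs H).map fun μ =>
    (1 + ρ ^ 2 / radius ε μ ^ 2) ^ (if μ.im = 0 then (1 / 2 : ℝ) else (1 / 4 : ℝ))).prod

/-- The entry `e_kᴴ φ_ℓ(-t H_k) e₁`. -/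
def cornerEntry {n : ℕ} (A : Matrix (Fin n) (Fin n) ℝ) (v : EuclideanSpace ℝ (Fin n)) (ℓ : ℕ)
    {k : ℕ} (hk : 1 ≤ k) (t : ℝ) : ℝ :=
  phi ℓ ((-t) • hessenberg A v k) ⟨k - 1, Nat.sub_one_lt_of_lt hk⟩ ⟨0, hk⟩

/-- The constant `c_{ℓ,k}`. -/
def errorConst {n : ℕ} (A : Matrix (Fin n) (Fin n) ℝ) (v : EuclideanSpace ℝ (Fin n)) (ℓ : ℕ)
    {k : ℕ} (hk : 1 ≤ k) (a ε t : ℝ) : ℝ :=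
  Real.exp (t * ε) / (Real.pi * (t * ε) ^ ℓ * omega (hessenberg A v k) ε * (ε + a)) *
    ((∏ j ∈ Finset.range (k - 1), arnoldiCoeff A v (j + 1) j) / |cornerEntry A v ℓ hk t|)

/-- The integrand `(1 + ρ²/ε²)^(-ℓ/2) / ς_k(ρ)`. -/
def errorIntegrand {k : ℕ} (H : Matrix (Fin k) (Fin k) ℝ) (ℓ : ℕ) (ε ρ : ℝ) : ℝ :=
  (1 + ρ ^ 2 / ε ^ 2) ^ (-(ℓ : ℝ) / 2) / varsigma H ε ρ

end

end ArnoldiPhi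

namespace ArnoldiPhi

open NormedSpace

/-! Multiplying the error by $s^\ell$ removes the singular term $\ell/s$. By the Arnoldi relation
the scaled error $E(s)=s^\ell\mathbf e_{\ell,k}(s)$ satisfies $E'=-AE-\beta x(s)w_k$, $E(0)=0$,
where $w_k$ is the unnormalized next Arnoldi vector and $x(s)$ is the $(k,1)$ entry of
$s^\ell\varphi_\ell(-sH_k)$. The residual is exactly $-\beta\,(\mathbf e_k^{\rm
T}\varphi_\ell(-tH_k)\mathbf e_1)\,w_k$, so $\beta\|w_k\|$ is the residual norm divided by the
corner entry (`arnoldiResidual_eq`).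

The sector condition gives $x^{\rm T}Ax\ge a|x|^2$ for real $x$, hence $\|e^{-sA}\|\le e^{-as}$, and
Duhamel's formula turns a bound $|x(s)|\le Ce^{\varepsilon s}$ into
$\|E(t)\|\le\beta\|w_k\|Ce^{t\varepsilon}/(\varepsilon+a)$ (`norm_scaledError_le`).

To find $C$, take the Laplace transform of $x$. By Cramer's rule it is, up to sign, $\prod
h_{j+1,j}/(z^\ell\det(z+H_k))$, because the relevant minor of a Hessenberg matrix is triangular
(`norm_laplace_corner`). On $\operatorname{Re}z=\varepsilon$, pairing each eigenvalue with its
conjugate gives $|\det(z+H_k)|\ge\omega_k\varsigma_k$ (`omega_mul_varsigma_le`). The count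
$k+k_1+2\ell\ge4$ makes the resulting majorant integrable, and Fourier inversion bounds $x$
(`abs_le_of_norm_laplace_le`). -/

/-- The symmetric part of `B` is bounded below by `a`. -/
def CoerciveBy {m : ℕ} (B : Matrix (Fin m) (Fin m) ℝ) (a : ℝ) : Prop :=
  ∀ x : Fin m → ℝ, a * (x ⬝ᵥ x) ≤ x ⬝ᵥ B.mulVec x

/-! ### Matrix exponentials and their decay under coercivity -/

theorem hasDerivAt_exp_smul_entry {m : ℕ} (M : Matrix (Fin m) (Fin m) ℝ) (i j : Fin m) (s : ℝ) :
    HasDerivAt (fun u : ℝ => exp (u • M) i j) ((M * exp (s • M)) i j) s := by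
  let _ : NormedRing (Matrix (Fin m) (Fin m) ℝ) := Matrix.linftyOpNormedRing
  let _ : NormedAlgebra ℝ (Matrix (Fin m) (Fin m) ℝ) := Matrix.linftyOpNormedAlgebra
  have h : HasDerivAt (fun u : ℝ => exp (u • M)) (M * exp (s • M)) s :=
    hasDerivAt_exp_smul_const' M s
  let L : Matrix (Fin m) (Fin m) ℝ →L[ℝ] ℝ :=
    LinearMap.toContinuousLinearMap (Matrix.entryLinearMap ℝ ℝ i j)
  exact L.hasFDerivAt.comp_hasDerivAt s h

theorem continuous_exp_smul_entry {m : ℕ} (M : Matrix (Fin m) (Fin m) ℝ) (i j : Fin m) :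
    Continuous (fun u : ℝ => exp (u • M) i j) :=
  continuous_iff_continuousAt.2 fun s => (hasDerivAt_exp_smul_entry M i j s).continuousAt

theorem exp_add_smul {m : ℕ} (M : Matrix (Fin m) (Fin m) ℝ) (s u : ℝ) :
    exp ((s + u) • M) = exp (s • M) * exp (u • M) := by
  rw [add_smul]
  exact Matrix.exp_add_of_commute _ _ (((Commute.refl M).smul_left s).smul_right u)

theorem exp_smul_mul_exp_neg_smul {m : ℕ} (M : Matrix (Fin m) (Fin m) ℝ) (s : ℝ) :
    exp (s • M) * exp ((-s) • M) = 1 := by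
  rw [← exp_add_smul]
  simp

theorem exp_smul_mul_comm {m : ℕ} (M : Matrix (Fin m) (Fin m) ℝ) (s : ℝ) :
    exp (s • M) * M = M * exp (s • M) := by
  let _ : NormedRing (Matrix (Fin m) (Fin m) ℝ) := Matrix.linftyOpNormedRing
  let _ : NormedAlgebra ℝ (Matrix (Fin m) (Fin m) ℝ) := Matrix.linftyOpNormedAlgebra
  exact ((Commute.refl M).smul_left s).exp_left.eq

theorem hasDerivAt_exp_neg_smul_entry {m : ℕ} (M : Matrix (Fin m) (Fin m) ℝ) (i j : Fin m)
    (s : ℝ) :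
    HasDerivAt (fun u : ℝ => exp ((-u) • M) i j) (-(M * exp ((-s) • M)) i j) s := by
  have h := hasDerivAt_exp_smul_entry (-M) i j s
  simpa [smul_neg, neg_smul, Matrix.neg_mul] using h

/-- `exp(-sB)` contracts by the factor `exp(-as)`. -/
theorem exp_neg_smul_mulVec_dotProduct_le {m : ℕ} {B : Matrix (Fin m) (Fin m) ℝ} {a : ℝ}
    (hB : CoerciveBy B a) {s : ℝ} (hs : 0 ≤ s) (x : Fin m → ℝ) :
    (exp ((-s) • B)).mulVec x ⬝ᵥ (exp ((-s) • B)).mulVec x ≤ Real.exp (-(2 * a * s)) * (x ⬝ᵥ x) := by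
  set y : ℝ → Fin m → ℝ := fun u => (exp ((-u) • B)).mulVec x with hy
  have hyd : ∀ u i, HasDerivAt (fun u => y u i) (-(B.mulVec (y u)) i) u := by
    intro u i
    have h : HasDerivAt (fun u => y u i) (∑ j, -(B * exp ((-u) • B)) i j * x j) u := by
      simp only [hy, Matrix.mulVec, dotProduct]
      exact HasDerivAt.fun_sum fun j _ => (hasDerivAt_exp_neg_smul_entry B i j u).mul_const _
    convert h using 1
    rw [show B.mulVec (y u) = (B * exp ((-u) • B)).mulVec x from Matrix.mulVec_mulVec _ _ _]
    simp only [Matrix.mulVec, dotProduct, neg_mul, Finset.sum_neg_distrib]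
  have hq : ∀ u, HasDerivAt (fun u => y u ⬝ᵥ y u) (-2 * (y u ⬝ᵥ B.mulVec (y u))) u := by
    intro u
    have h : HasDerivAt (fun u => ∑ i, y u i * y u i)
        (∑ i, (-(B.mulVec (y u)) i * y u i + y u i * -(B.mulVec (y u)) i)) u :=
      HasDerivAt.fun_sum fun i _ => (hyd u i).mul (hyd u i)
    refine h.congr_deriv ?_
    rw [dotProduct, Finset.mul_sum]
    exact Finset.sum_congr rfl fun i _ => by ring
  -- Energy argument: coercivity makes the derivative of $e^{2au}|y(u)|^2$ nonpositive.
  have hF : ∀ u, HasDerivAt (fun u => Real.exp (2 * a * u) * (y u ⬝ᵥ y u))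
      (Real.exp (2 * a * u) * (2 * a) * (y u ⬝ᵥ y u) +
        Real.exp (2 * a * u) * (-2 * (y u ⬝ᵥ B.mulVec (y u)))) u := by
    intro u
    have h1 : HasDerivAt (fun u : ℝ => 2 * a * u) (2 * a) u := by
      simpa using (hasDerivAt_id u).const_mul (2 * a)
    exact h1.exp.mul (hq u)
  have hanti : Antitone fun u => Real.exp (2 * a * u) * (y u ⬝ᵥ y u) := by
    refine antitone_of_hasDerivAt_nonpos hF fun u => ?_
    rw [Pi.zero_apply]
    have := mul_le_mul_of_nonneg_left (hB (y u)) (Real.exp_pos (2 * a * u)).le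
    linarith
  have h0 := hanti hs
  have hy0 : y 0 = x := by simp [hy]
  simp only [hy0, mul_zero, Real.exp_zero, one_mul] at h0
  rw [Real.exp_neg, ← div_eq_inv_mul, le_div_iff₀ (Real.exp_pos _), mul_comm]
  exact h0

theorem abs_exp_neg_smul_entry_le_one {m : ℕ} {B : Matrix (Fin m) (Fin m) ℝ} {a : ℝ}
    (hB : CoerciveBy B a) (ha : 0 ≤ a) {s : ℝ} (hs : 0 ≤ s) (i j : Fin m) :
    |exp ((-s) • B) i j| ≤ 1 := by
  have h := exp_neg_smul_mulVec_dotProduct_le hB hs (Pi.single j 1)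
  have h1 : Real.exp (-(2 * a * s)) ≤ 1 := Real.exp_le_one_iff.2 (by
    have := mul_nonneg ha hs
    linarith)
  rw [Matrix.mulVec_single_one] at h
  simp only [single_one_dotProduct, Pi.single_eq_same, mul_one] at h
  have h2 : exp ((-s) • B) i j * exp ((-s) • B) i j ≤
      (exp ((-s) • B)).col j ⬝ᵥ (exp ((-s) • B)).col j :=
    Finset.single_le_sum (f := fun i => exp ((-s) • B) i j * exp ((-s) • B) i j)
      (fun i _ => mul_self_nonneg _) (Finset.mem_univ i)
  rw [← sq_le_one_iff_abs_le_one, sq]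
  linarith

/-! ### The scaled functions $s^\ell\varphi_\ell(-sM)$ -/

/-- `s ^ ℓ φ_ℓ(-sM)`. -/
noncomputable def scaledPhi {m : ℕ} (ℓ : ℕ) (M : Matrix (Fin m) (Fin m) ℝ) (s : ℝ) :
    Matrix (Fin m) (Fin m) ℝ :=
  s ^ ℓ • phi ℓ ((-s) • M)

/-- The inhomogeneity in the differential equation of `scaledPhi`. -/
noncomputable def forcing : ℕ → ℝ → ℝ
  | 0, _ => 0
  | ℓ + 1, s => s ^ ℓ / (ℓ.factorial : ℝ)

theorem scaledPhi_zero {m : ℕ} (M : Matrix (Fin m) (Fin m) ℝ) (s : ℝ) :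
    scaledPhi 0 M s = exp ((-s) • M) := by
  simp [scaledPhi, phi]

/-- The substitution $\sigma=s\theta$ yields the variation-of-constants form, in which $s$ occurs
only in an exponential and in an upper limit of integration, so that it can be differentiated
directly. No division by $s$ occurs, and $s=0$ is included. -/
theorem scaledPhi_succ_apply {m : ℕ} (ℓ : ℕ) (M : Matrix (Fin m) (Fin m) ℝ) (s : ℝ)
    (i j : Fin m) :
    scaledPhi (ℓ + 1) M s i j =
      ∑ l, exp ((-s) • M) i l *
        (1 / (ℓ.factorial : ℝ) * ∫ σ in (0 : ℝ)..s, exp (σ • M) l j * σ ^ ℓ) := by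
  have hcont : ∀ l, Continuous fun σ : ℝ => exp (σ • M) l j * σ ^ ℓ := fun l =>
    (continuous_exp_smul_entry M l j).mul (continuous_pow ℓ)
  have hsplit : ∀ θ : ℝ, exp ((1 - θ) • (-s) • M) i j * θ ^ ℓ * s ^ ℓ =
      ∑ l, exp ((-s) • M) i l * (exp ((s * θ) • M) l j * (s * θ) ^ ℓ) := by
    intro θ
    have : (1 - θ) • (-s) • M = ((-s) + s * θ) • M := by
      rw [smul_smul]
      congr 1
      ring
    rw [this, exp_add_smul, Matrix.mul_apply, mul_pow, mul_assoc, Finset.sum_mul]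
    exact Finset.sum_congr rfl fun l _ => by ring
  have hint : s ^ (ℓ + 1) * ∫ θ in (0 : ℝ)..1, exp ((1 - θ) • (-s) • M) i j * θ ^ ℓ =
      ∑ l, exp ((-s) • M) i l * ∫ σ in (0 : ℝ)..s, exp (σ • M) l j * σ ^ ℓ := by
    calc s ^ (ℓ + 1) * ∫ θ in (0 : ℝ)..1, exp ((1 - θ) • (-s) • M) i j * θ ^ ℓ
        = s * ∫ θ in (0 : ℝ)..1, exp ((1 - θ) • (-s) • M) i j * θ ^ ℓ * s ^ ℓ := by
          rw [intervalIntegral.integral_mul_const]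
          ring
      _ = s * ∫ θ in (0 : ℝ)..1,
            ∑ l, exp ((-s) • M) i l * (exp ((s * θ) • M) l j * (s * θ) ^ ℓ) := by
          simp only [hsplit]
      _ = s * ∑ l, exp ((-s) • M) i l *
            ∫ θ in (0 : ℝ)..1, (exp ((s * θ) • M) l j * (s * θ) ^ ℓ) := by
          rw [intervalIntegral.integral_finsetSum]
          · simp only [intervalIntegral.integral_const_mul]
          · intro l _
            exact (((hcont l).comp (continuous_const.mul continuous_id)).const_mul
              _).intervalIntegrable _ _
      _ = _ := by
          rw [Finset.mul_sum]
          refine Finset.sum_congr rfl fun l _ => ?_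
          have := intervalIntegral.smul_integral_comp_mul_left (a := 0) (b := 1)
            (fun σ : ℝ => exp (σ • M) l j * σ ^ ℓ) s
          simp only [smul_eq_mul, mul_zero, mul_one] at this
          rw [← this]
          ring
  simp only [scaledPhi, phi, Matrix.smul_apply, Matrix.of_apply, smul_eq_mul]
  rw [mul_left_comm, hint, Finset.mul_sum]
  exact Finset.sum_congr rfl fun l _ => by ring

theorem scaledPhi_at_zero {m : ℕ} (ℓ : ℕ) (M : Matrix (Fin m) (Fin m) ℝ) :
    scaledPhi ℓ M 0 = if ℓ = 0 then 1 else 0 := by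
  cases ℓ with
  | zero => simp [scaledPhi_zero]
  | succ ℓ => simp [scaledPhi]

/-- The factor $s^\ell$ makes this linear equation regular at $0$; for `ℓ = 0` the source vanishes
and the initial value drives the solution instead. -/
theorem hasDerivAt_scaledPhi {m : ℕ} (ℓ : ℕ) (M : Matrix (Fin m) (Fin m) ℝ) (s : ℝ)
    (i j : Fin m) :
    HasDerivAt (fun u => scaledPhi ℓ M u i j)
      (-(M * scaledPhi ℓ M s) i j + forcing ℓ s * (1 : Matrix (Fin m) (Fin m) ℝ) i j) s := by
  cases ℓ with
  | zero =>
    simp only [scaledPhi_zero, forcing, zero_mul, add_zero]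
    exact hasDerivAt_exp_neg_smul_entry M i j s
  | succ ℓ =>
    have hcont : ∀ l, Continuous fun σ : ℝ => exp (σ • M) l j * σ ^ ℓ := fun l =>
      (continuous_exp_smul_entry M l j).mul (continuous_pow ℓ)
    set J : Fin m → ℝ → ℝ := fun l s =>
      1 / (ℓ.factorial : ℝ) * ∫ σ in (0 : ℝ)..s, exp (σ • M) l j * σ ^ ℓ with hJ
    have hJd : ∀ l, HasDerivAt (J l) (1 / (ℓ.factorial : ℝ) * (exp (s • M) l j * s ^ ℓ)) s :=
      fun l => (intervalIntegral.integral_hasDerivAt_right ((hcont l).intervalIntegrable _ _)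
        ((hcont l).stronglyMeasurableAtFilter _ _) (hcont l).continuousAt).const_mul _
    have h : HasDerivAt (fun u => ∑ l, exp ((-u) • M) i l * J l u)
        (∑ l, (-(M * exp ((-s) • M)) i l * J l s +
          exp ((-s) • M) i l * (1 / (ℓ.factorial : ℝ) * (exp (s • M) l j * s ^ ℓ)))) s :=
      HasDerivAt.fun_sum fun l _ => (hasDerivAt_exp_neg_smul_entry M i l s).mul (hJd l)
    simp only [scaledPhi_succ_apply]
    convert h using 1
    rw [Finset.sum_add_distrib]
    congr 1
    · have : scaledPhi (ℓ + 1) M s =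
          Matrix.of fun i j => ∑ l, exp ((-s) • M) i l *
            (1 / (ℓ.factorial : ℝ) * ∫ σ in (0 : ℝ)..s, exp (σ • M) l j * σ ^ ℓ) := by
        ext i j
        exact scaledPhi_succ_apply ℓ M s i j
      rw [this]
      simp only [Matrix.mul_apply, Matrix.of_apply, neg_mul, Finset.sum_neg_distrib, neg_inj,
        Finset.mul_sum, Finset.sum_mul]
      rw [Finset.sum_comm]
      exact Finset.sum_congr rfl fun l _ => Finset.sum_congr rfl fun r _ => by
        simp only [hJ]; ring
    · have h1 : (exp ((-s) • M) * exp (s • M)) i j = (1 : Matrix (Fin m) (Fin m) ℝ) i j := by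
        have := exp_smul_mul_exp_neg_smul M (-s)
        rw [neg_neg] at this
        rw [this]
      rw [← h1, Matrix.mul_apply, Finset.mul_sum]
      exact Finset.sum_congr rfl fun l _ => by simp only [forcing]; ring

theorem continuous_scaledPhi {m : ℕ} (ℓ : ℕ) (M : Matrix (Fin m) (Fin m) ℝ) (i j : Fin m) :
    Continuous fun u => scaledPhi ℓ M u i j :=
  continuous_iff_continuousAt.2 fun s => (hasDerivAt_scaledPhi ℓ M s i j).continuousAt

/-- A crude polynomial bound, enough for the Laplace integrals to converge on
$\operatorname{Re}z>0$. -/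
theorem abs_scaledPhi_le {m : ℕ} {B : Matrix (Fin m) (Fin m) ℝ} {a : ℝ}
    (hB : CoerciveBy B a) (ha : 0 ≤ a) (ℓ : ℕ) {s : ℝ} (hs : 0 ≤ s) (i j : Fin m) :
    |scaledPhi ℓ B s i j| ≤ s ^ ℓ := by
  cases ℓ with
  | zero =>
    rw [scaledPhi_zero, pow_zero]
    exact abs_exp_neg_smul_entry_le_one hB ha hs i j
  | succ ℓ =>
    simp only [scaledPhi, phi, Matrix.smul_apply, Matrix.of_apply, smul_eq_mul]
    rw [abs_mul, abs_of_nonneg (pow_nonneg hs _)]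
    refine mul_le_of_le_one_right (pow_nonneg hs _) ?_
    have hint : ‖∫ θ in (0 : ℝ)..1, exp ((1 - θ) • (-s) • B) i j * θ ^ ℓ‖ ≤ 1 * |(1 : ℝ) - 0| := by
      refine intervalIntegral.norm_integral_le_of_norm_le_const fun θ hθ => ?_
      rw [Set.uIoc_of_le zero_le_one] at hθ
      have h1 : (1 - θ) • (-s) • B = (-((1 - θ) * s)) • B := by
        rw [smul_smul]
        congr 1
        ring
      rw [h1, Real.norm_eq_abs, abs_mul, abs_pow, abs_of_pos hθ.1]
      exact mul_le_one₀ (abs_exp_neg_smul_entry_le_one hB ha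
        (mul_nonneg (by linarith [hθ.2]) hs) i j) (pow_nonneg hθ.1.le _)
        (pow_le_one₀ hθ.1.le hθ.2)
    have hf : (1 : ℝ) ≤ ℓ.factorial := by exact_mod_cast Nat.one_le_iff_ne_zero.2 ℓ.factorial_ne_zero
    rw [abs_mul, abs_of_nonneg (by positivity : (0 : ℝ) ≤ 1 / ℓ.factorial)]
    refine mul_le_one₀ ?_ (abs_nonneg _) (by simpa using hint)
    rw [div_le_one (by positivity)]
    exact hf

/-! ### From the numerical range to coercivity -/

theorem inner_eq_dotProduct {n : ℕ} (x y : EuclideanSpace ℝ (Fin n)) :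
    inner ℝ x y = x.ofLp ⬝ᵥ y.ofLp := by
  rw [EuclideanSpace.inner_eq_star_dotProduct, dotProduct_comm]
  simp

theorem coerciveBy_of_numericalRange {n : ℕ} {A : Matrix (Fin n) (Fin n) ℝ} {ϑ a : ℝ}
    (hϑ : ϑ ≤ Real.pi / 2) (hW : numericalRange A ⊆ sector ϑ a) : CoerciveBy A a := by
  intro x
  by_cases hx : x = 0
  · simp [hx]
  set z : EuclideanSpace ℂ (Fin n) := WithLp.toLp 2 (fun i => (x i : ℂ)) with hz
  have hz0 : z ≠ 0 := by
    intro h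
    apply hx
    ext i
    have := congrArg (fun y : EuclideanSpace ℂ (Fin n) => y i) h
    simpa [hz] using this
  have h1 : inner ℂ z (Matrix.toEuclideanLin (A.map (fun s : ℝ => (s : ℂ))) z) =
      ((x ⬝ᵥ A.mulVec x : ℝ) : ℂ) := by
    rw [EuclideanSpace.inner_eq_star_dotProduct, dotProduct_comm]
    simp [hz, dotProduct, Matrix.mulVec, Matrix.toLpLin_apply]
  have h2 : inner ℂ z z = ((x ⬝ᵥ x : ℝ) : ℂ) := by
    rw [EuclideanSpace.inner_eq_star_dotProduct, dotProduct_comm]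
    simp [hz, dotProduct]
  have hmem := hW ⟨z, hz0, rfl⟩
  simp only [sector, Set.mem_ofPred_eq] at hmem
  -- A half-angle at most $\pi/2$ places the sector in $\operatorname{Re}z\ge a$; this half-plane is
  -- all that is used of it.
  have hre := Complex.abs_arg_le_pi_div_two_iff.1 (hmem.trans hϑ)
  rw [h1, h2, ← Complex.ofReal_div, ← Complex.ofReal_sub, Complex.ofReal_re] at hre
  have hpos : 0 < x ⬝ᵥ x := by
    rcases (Finset.sum_nonneg fun i _ => mul_self_nonneg (x i) : 0 ≤ x ⬝ᵥ x).lt_or_eq with h | h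
    · exact h
    · exact absurd (dotProduct_self_eq_zero.1 h.symm) hx
  rw [sub_nonneg, le_div_iff₀ hpos] at hre
  exact hre

/-! ### The Arnoldi basis and the Arnoldi relation -/

section Arnoldi

variable {n : ℕ} (A : Matrix (Fin n) (Fin n) ℝ) (v : EuclideanSpace ℝ (Fin n))

theorem arnoldiCoeff_of_le {i j : ℕ} (h : i ≤ j) :
    arnoldiCoeff A v i j =
      inner ℝ (arnoldiVec A v i) (Matrix.toEuclideanLin A (arnoldiVec A v j)) := by
  simp [arnoldiCoeff, h]

theorem arnoldiCoeff_succ (j : ℕ) : arnoldiCoeff A v (j + 1) j = ‖arnoldiNext A v j‖ := by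
  simp [arnoldiCoeff]

theorem arnoldiCoeff_of_lt {i j : ℕ} (h : j + 1 < i) : arnoldiCoeff A v i j = 0 := by
  simp only [arnoldiCoeff]
  rw [if_neg (by omega), if_neg (by omega)]

theorem arnoldiNext_eq (j : ℕ) :
    arnoldiNext A v j = Matrix.toEuclideanLin A (arnoldiVec A v j) -
      ∑ i ∈ Finset.range (j + 1), arnoldiCoeff A v i j • arnoldiVec A v i := by
  rw [arnoldiNext, ← Fin.sum_univ_eq_sum_range
    (fun i => arnoldiCoeff A v i j • arnoldiVec A v i)]
  congr 1
  exact Finset.sum_congr rfl fun i _ => by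
    rw [arnoldiCoeff_of_le A v (Nat.lt_succ_iff.1 i.2)]

theorem arnoldiCoeff_smul_arnoldiVec {j : ℕ} (h : arnoldiCoeff A v (j + 1) j ≠ 0) :
    arnoldiCoeff A v (j + 1) j • arnoldiVec A v (j + 1) = arnoldiNext A v j := by
  rw [arnoldiVec_succ, smul_smul, arnoldiCoeff_succ, mul_inv_cancel₀, one_smul]
  rwa [arnoldiCoeff_succ] at h

theorem inner_arnoldiNext_of_orthonormal {m : ℕ}
    (ho : ∀ i < m + 1, ∀ j < m + 1,
      inner ℝ (arnoldiVec A v i) (arnoldiVec A v j) = if i = j then (1 : ℝ) else 0)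
    {i : ℕ} (hi : i < m + 1) : inner ℝ (arnoldiVec A v i) (arnoldiNext A v m) = 0 := by
  rw [arnoldiNext_eq, inner_sub_right, inner_sum, Finset.sum_eq_single i]
  · rw [inner_smul_right, ho i hi i hi, if_pos rfl, mul_one,
      arnoldiCoeff_of_le A v (Nat.lt_succ_iff.1 hi), sub_self]
  · intro j hj hji
    rw [inner_smul_right, ho i hi j (Finset.mem_range.1 hj), if_neg hji.symm, mul_zero]
  · intro h
    exact absurd (Finset.mem_range.2 hi) h

variable {v} {k : ℕ}

/-- Gram–Schmidt, by induction on the number of vectors. A nonzero subdiagonal entry matters only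
for the unit norm of the next vector, so entries with `j + 1 < k` suffice. -/
theorem arnoldiVec_orthonormal (hv : v ≠ 0)
    (hA : ∀ j : ℕ, j + 1 < k → arnoldiCoeff A v (j + 1) j ≠ 0) :
    ∀ m ≤ k, ∀ i < m, ∀ j < m,
      inner ℝ (arnoldiVec A v i) (arnoldiVec A v j) = if i = j then (1 : ℝ) else 0 := by
  intro m
  induction m with
  | zero => intro _ i hi; omega
  | succ m ih =>
    intro hm
    have ho := ih (by omega)
    have hnew : inner ℝ (arnoldiVec A v m) (arnoldiVec A v m) = (1 : ℝ) := by
      rw [real_inner_self_eq_norm_sq]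
      cases m with
      | zero => simp [arnoldiVec_zero, norm_smul, hv]
      | succ p =>
        have := hA p (by omega)
        rw [arnoldiCoeff_succ] at this
        rw [arnoldiVec_succ, norm_smul, norm_inv, norm_norm, inv_mul_cancel₀ this, one_pow]
    have hort : ∀ i < m, inner ℝ (arnoldiVec A v i) (arnoldiVec A v m) = (0 : ℝ) := by
      intro i hi
      cases m with
      | zero => omega
      | succ p =>
        rw [arnoldiVec_succ, inner_smul_right, inner_arnoldiNext_of_orthonormal A v ho hi,
          mul_zero]
    intro i hi j hj
    rcases Nat.lt_succ_iff_lt_or_eq.1 hi with hi' | rfl <;>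
      rcases Nat.lt_succ_iff_lt_or_eq.1 hj with hj' | rfl
    · exact ho i hi' j hj'
    · rw [hort i hi', if_neg hi'.ne]
    · rw [real_inner_comm, hort j hj', if_neg hj'.ne']
    · rw [hnew, if_pos rfl]

variable (v) in
/-- The linear combination `V_k x` of the Arnoldi vectors. -/
noncomputable def arnoldiComb (x : Fin k → ℝ) : EuclideanSpace ℝ (Fin n) :=
  ∑ j : Fin k, x j • arnoldiVec A v j.1

theorem arnoldiComb_add (x y : Fin k → ℝ) :
    arnoldiComb A v (x + y) = arnoldiComb A v x + arnoldiComb A v y := by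
  simp [arnoldiComb, add_smul, Finset.sum_add_distrib]

theorem arnoldiComb_smul (r : ℝ) (x : Fin k → ℝ) :
    arnoldiComb A v (r • x) = r • arnoldiComb A v x := by
  simp [arnoldiComb, Finset.smul_sum, smul_smul]

theorem inner_arnoldiComb (hv : v ≠ 0)
    (hA : ∀ j : ℕ, j + 1 < k → arnoldiCoeff A v (j + 1) j ≠ 0) (x y : Fin k → ℝ) :
    inner ℝ (arnoldiComb A v x) (arnoldiComb A v y) = x ⬝ᵥ y := by
  simp only [arnoldiComb, sum_inner, inner_sum, inner_smul_left, inner_smul_right, dotProduct]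
  refine Finset.sum_congr rfl fun i _ => ?_
  rw [Finset.sum_eq_single i]
  · rw [arnoldiVec_orthonormal A hv hA k le_rfl i i.2 i i.2]
    simp [mul_comm]
  · intro j _ hji
    rw [arnoldiVec_orthonormal A hv hA k le_rfl _ j.2 _ i.2,
      if_neg fun h => hji (Fin.ext h)]
    simp
  · simp

theorem inner_arnoldiComb_arnoldiNext (hk : 1 ≤ k) (hv : v ≠ 0)
    (hA : ∀ j : ℕ, j + 1 < k → arnoldiCoeff A v (j + 1) j ≠ 0) (x : Fin k → ℝ) :
    inner ℝ (arnoldiComb A v x) (arnoldiNext A v (k - 1)) = 0 := by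
  obtain ⟨m, rfl⟩ : ∃ m, k = m + 1 := ⟨k - 1, by omega⟩
  simp only [arnoldiComb, sum_inner, inner_smul_left]
  refine Finset.sum_eq_zero fun i _ => ?_
  rw [Nat.add_sub_cancel, inner_arnoldiNext_of_orthonormal A v
    (arnoldiVec_orthonormal A hv hA (m + 1) le_rfl) i.2, mul_zero]

/-- The Arnoldi relation `A v_j = ∑ h_{i,j} v_i + δ_{j,k} w_k`. -/
theorem toEuclideanLin_arnoldiVec
    (hA : ∀ j : ℕ, j + 1 < k → arnoldiCoeff A v (j + 1) j ≠ 0) (j : Fin k) :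
    Matrix.toEuclideanLin A (arnoldiVec A v j) =
      arnoldiComb A v (fun i => hessenberg A v k i j) +
        if j.1 = k - 1 then arnoldiNext A v (k - 1) else 0 := by
  have hj := j.2
  have hsum : arnoldiComb A v (fun i => hessenberg A v k i j) =
      ∑ i ∈ Finset.range k, arnoldiCoeff A v i j • arnoldiVec A v i := by
    rw [← Fin.sum_univ_eq_sum_range (fun i => arnoldiCoeff A v i j • arnoldiVec A v i)]
    rfl
  have hnext := arnoldiNext_eq A v j
  rw [hsum]
  split_ifs with h
  · have hkj : Finset.range k = Finset.range (j.1 + 1) := congrArg _ (by omega)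
    rw [← h, hnext, hkj]
    abel
  · have hlt : j.1 + 1 < k := by omega
    rw [← Finset.sum_subset (s₁ := Finset.range (j.1 + 1 + 1)), Finset.sum_range_succ,
      arnoldiCoeff_smul_arnoldiVec A v (hA j hlt), hnext]
    · abel
    · exact Finset.range_subset_range.2 (by omega)
    · intro i _ hi
      rw [arnoldiCoeff_of_lt A v (by simpa using hi), zero_smul]

/-- Keeping $w_k$ unnormalized allows breakdown at step $k$ itself, where $w_k=0$. -/
theorem toEuclideanLin_arnoldiComb (hk : 1 ≤ k)
    (hA : ∀ j : ℕ, j + 1 < k → arnoldiCoeff A v (j + 1) j ≠ 0) (x : Fin k → ℝ) :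
    Matrix.toEuclideanLin A (arnoldiComb A v x) =
      arnoldiComb A v ((hessenberg A v k).mulVec x) +
        x ⟨k - 1, Nat.sub_one_lt_of_lt hk⟩ • arnoldiNext A v (k - 1) := by
  have h1 : Matrix.toEuclideanLin A (arnoldiComb A v x) =
      ∑ j : Fin k, x j • Matrix.toEuclideanLin A (arnoldiVec A v j) := by
    simp only [arnoldiComb, map_sum, map_smul]
  rw [h1]
  simp only [toEuclideanLin_arnoldiVec A hA, smul_add, Finset.sum_add_distrib]
  congr 1
  · simp only [arnoldiComb, Finset.smul_sum, smul_smul]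
    rw [Finset.sum_comm]
    refine Finset.sum_congr rfl fun i _ => ?_
    rw [← Finset.sum_smul]
    congr 1
    exact Finset.sum_congr rfl fun j _ => mul_comm _ _
  · rw [Finset.sum_eq_single ⟨k - 1, Nat.sub_one_lt_of_lt hk⟩]
    · simp
    · intro j _ hj
      rw [if_neg fun h => hj (Fin.ext h), smul_zero]
    · simp

/-- Since $w_k$ is orthogonal to the range of the isometry $V_k$, the form of $H_k$ is the
restriction of the form of $A$ to that range. -/
theorem CoerciveBy.hessenberg {a : ℝ} {A} (hC : CoerciveBy A a) (hk : 1 ≤ k) (hv : v ≠ 0)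
    (hA : ∀ j : ℕ, j + 1 < k → arnoldiCoeff A v (j + 1) j ≠ 0) :
    CoerciveBy (hessenberg A v k) a := by
  intro x
  have h := hC (arnoldiComb A v x).ofLp
  have h1 : x ⬝ᵥ (ArnoldiPhi.hessenberg A v k).mulVec x =
      inner ℝ (arnoldiComb A v x) (Matrix.toEuclideanLin A (arnoldiComb A v x)) := by
    rw [toEuclideanLin_arnoldiComb A hk hA, inner_add_right, inner_arnoldiComb A hv hA,
      inner_smul_right, inner_arnoldiComb_arnoldiNext A hk hv hA, mul_zero, add_zero]
  rw [h1, ← inner_arnoldiComb A hv hA x x, inner_eq_dotProduct, inner_eq_dotProduct]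
  exact h

theorem norm_smul_arnoldiComb_single (hk : 1 ≤ k) (hv : v ≠ 0) :
    ‖v‖ • arnoldiComb A v (Pi.single (⟨0, hk⟩ : Fin k) 1) = v := by
  rw [arnoldiComb, Finset.sum_eq_single ⟨0, hk⟩]
  · simp [arnoldiVec_zero, smul_smul, hv]
  · intro j _ hj
    simp [Pi.single_eq_of_ne hj]
  · simp

theorem arnoldiApprox_eq (ℓ : ℕ) (hk : 1 ≤ k) (s : ℝ) :
    arnoldiApprox A v ℓ hk s = ‖v‖ •
      arnoldiComb A v (fun j => phi ℓ ((-s) • hessenberg A v k) j ⟨0, hk⟩) := by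
  simp only [arnoldiApprox, arnoldiComb, Finset.smul_sum, smul_smul]
  refine Finset.sum_congr rfl fun j _ => ?_
  simp [Matrix.mulVec_single, mul_comm]

end Arnoldi

/-! ### The derivative of $\varphi_\ell$ and the residual -/

theorem phi_eq_scaledPhi {m : ℕ} (ℓ : ℕ) (M : Matrix (Fin m) (Fin m) ℝ) {s : ℝ} (hs : 0 < s)
    (i j : Fin m) : phi ℓ ((-s) • M) i j = (s ^ ℓ)⁻¹ * scaledPhi ℓ M s i j := by
  simp only [scaledPhi, Matrix.smul_apply, smul_eq_mul]
  rw [inv_mul_cancel_left₀ (pow_pos hs ℓ).ne']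

theorem hasDerivAt_phi {m : ℕ} (ℓ : ℕ) (M : Matrix (Fin m) (Fin m) ℝ) {t : ℝ} (ht : 0 < t)
    (i j : Fin m) :
    HasDerivAt (fun s : ℝ => phi ℓ ((-s) • M) i j)
      (-(M * phi ℓ ((-t) • M)) i j - ℓ / t * phi ℓ ((-t) • M) i j +
        forcing ℓ t / t ^ ℓ * (1 : Matrix (Fin m) (Fin m) ℝ) i j) t := by
  have htl := (pow_pos ht ℓ).ne'
  have h1 : HasDerivAt (fun s : ℝ => (s ^ ℓ)⁻¹) (-(ℓ * t ^ (ℓ - 1)) / (t ^ ℓ) ^ 2) t :=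
    (hasDerivAt_pow ℓ t).fun_inv htl
  have h2 := h1.mul (hasDerivAt_scaledPhi ℓ M t i j)
  have h3 := h2.congr_of_eventuallyEq (f₁ := fun s : ℝ => phi ℓ ((-s) • M) i j) (by
    filter_upwards [lt_mem_nhds ht] with s hs
    exact phi_eq_scaledPhi ℓ M hs i j)
  refine h3.congr_deriv ?_
  have h4 : (M * scaledPhi ℓ M t) i j = t ^ ℓ * (M * phi ℓ ((-t) • M)) i j := by
    rw [scaledPhi, Matrix.mul_smul, Matrix.smul_apply, smul_eq_mul]
  -- The exponent is a truncated difference; at `ℓ = 0` the factor `ℓ` makes both sides vanish.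
  have h5 : (ℓ : ℝ) * t ^ (ℓ - 1) = ℓ / t * t ^ ℓ := by
    cases ℓ with
    | zero => simp
    | succ p =>
      rw [Nat.add_sub_cancel, pow_succ]
      field_simp
  rw [h4, h5]
  simp only [scaledPhi, Matrix.smul_apply, smul_eq_mul]
  field_simp
  ring

section Residual

variable {n k : ℕ} {A : Matrix (Fin n) (Fin n) ℝ} {v : EuclideanSpace ℝ (Fin n)}

theorem arnoldiApprox_hasDerivAt (ℓ : ℕ) (hk : 1 ≤ k) (hv : v ≠ 0)
    (hA : ∀ j : ℕ, j + 1 < k → arnoldiCoeff A v (j + 1) j ≠ 0) {t : ℝ} (ht : 0 < t) :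
    HasDerivAt (fun s => arnoldiApprox A v ℓ hk s)
      (-Matrix.toEuclideanLin A (arnoldiApprox A v ℓ hk t) +
        (‖v‖ * cornerEntry A v ℓ hk t) • arnoldiNext A v (k - 1) -
        (ℓ / t : ℝ) • arnoldiApprox A v ℓ hk t + (forcing ℓ t / t ^ ℓ) • v) t := by
  set H := hessenberg A v k with hH
  have hd : HasDerivAt (fun s => arnoldiApprox A v ℓ hk s)
      (‖v‖ • arnoldiComb A v (fun j => -(H * phi ℓ ((-t) • H)) j ⟨0, hk⟩ -
        ℓ / t * phi ℓ ((-t) • H) j ⟨0, hk⟩ +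
        forcing ℓ t / t ^ ℓ * (1 : Matrix (Fin k) (Fin k) ℝ) j ⟨0, hk⟩)) t := by
    simp only [arnoldiApprox_eq, arnoldiComb]
    exact (HasDerivAt.fun_sum fun j _ =>
      (hasDerivAt_phi ℓ H ht j ⟨0, hk⟩).smul_const _).const_smul ‖v‖
  refine hd.congr_deriv ?_
  have hsplit : (fun j => -(H * phi ℓ ((-t) • H)) j ⟨0, hk⟩ -
        ℓ / t * phi ℓ ((-t) • H) j ⟨0, hk⟩ +
        forcing ℓ t / t ^ ℓ * (1 : Matrix (Fin k) (Fin k) ℝ) j ⟨0, hk⟩) =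
      (-1 : ℝ) • H.mulVec (fun j => phi ℓ ((-t) • H) j ⟨0, hk⟩) +
        (-(ℓ / t : ℝ)) • (fun j => phi ℓ ((-t) • H) j ⟨0, hk⟩) +
        (forcing ℓ t / t ^ ℓ) • Pi.single ⟨0, hk⟩ 1 := by
    ext j
    simp only [Pi.add_apply, Pi.smul_apply, smul_eq_mul, Matrix.one_apply, Pi.single_apply]
    rw [Matrix.mul_apply]
    simp only [Matrix.mulVec, dotProduct]
    ring
  have hcol := toEuclideanLin_arnoldiComb A hk hA (fun j => phi ℓ ((-t) • H) j ⟨0, hk⟩)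
  rw [hsplit, arnoldiComb_add, arnoldiComb_add, arnoldiComb_smul, arnoldiComb_smul,
    arnoldiComb_smul, arnoldiApprox_eq, map_smul, ← hH, hcol, cornerEntry, ← hH]
  have hfv : (forcing ℓ t / t ^ ℓ) • v = (forcing ℓ t / t ^ ℓ) • ‖v‖ •
      arnoldiComb A v (Pi.single (⟨0, hk⟩ : Fin k) 1) := by
    rw [norm_smul_arnoldiComb_single A hk hv]
  rw [hfv]
  module

/-- The approximation solves the projected equation, so only the component of $A V_k$ that leaves
the Krylov space survives. -/
theorem arnoldiResidual_eq (ℓ : ℕ) (hk : 1 ≤ k) (hv : v ≠ 0)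
    (hA : ∀ j : ℕ, j + 1 < k → arnoldiCoeff A v (j + 1) j ≠ 0) {t : ℝ} (ht : 0 < t) :
    arnoldiResidual A v ℓ hk t =
      -((‖v‖ * cornerEntry A v ℓ hk t) • arnoldiNext A v (k - 1)) := by
  have hd := (arnoldiApprox_hasDerivAt ℓ hk hv hA ht).deriv
  cases ℓ with
  | zero =>
    rw [arnoldiResidual, hd]
    simp [forcing]
  | succ ℓ =>
    have hf : forcing (ℓ + 1) t / t ^ (ℓ + 1) = 1 / (t * ℓ.factorial) := by
      rw [forcing, pow_succ]
      field_simp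
    rw [arnoldiResidual, hd, hf]
    abel

end Residual

/-! ### Laplace transforms -/

/-- The Laplace transform of a real function on the half-line. -/
noncomputable def laplace (f : ℝ → ℝ) (z : ℂ) : ℂ :=
  ∫ s in Set.Ioi (0 : ℝ), Complex.exp (-z * s) * (f s : ℂ)

/-- The Laplace integral of `f` at `z` converges absolutely. -/
def LaplaceConvergent (f : ℝ → ℝ) (z : ℂ) : Prop :=
  IntegrableOn (fun s : ℝ => Complex.exp (-z * s) * (f s : ℂ)) (Set.Ioi 0)

theorem laplaceConvergent_of_abs_le_pow {f : ℝ → ℝ} (hf : Continuous f) {N : ℕ}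
    (hN : ∀ s, 0 ≤ s → |f s| ≤ s ^ N) {z : ℂ} (hz : 0 < z.re) : LaplaceConvergent f z := by
  have hint : IntegrableOn (fun s : ℝ => s ^ N * Real.exp (-z.re * s)) (Set.Ioi 0) := by
    have h := integrableOn_rpow_mul_exp_neg_mul_rpow (p := 1) (s := N) (b := z.re)
      (by have : (0 : ℝ) ≤ N := N.cast_nonneg
          linarith) one_pos hz
    simpa using h
  refine Integrable.mono' hint ?_ ?_
  · exact (Continuous.mul (by fun_prop)
      (Complex.continuous_ofReal.comp hf)).aestronglyMeasurable
  · filter_upwards [ae_restrict_mem measurableSet_Ioi] with s hs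
    rw [norm_mul, Complex.norm_exp, Complex.norm_real, Real.norm_eq_abs, mul_comm]
    have : (-z * (s : ℂ)).re = -z.re * s := by simp
    rw [this]
    exact mul_le_mul_of_nonneg_right (hN s (le_of_lt hs)) (Real.exp_pos _).le

/-- Integration by parts. The boundary term at infinity vanishes because $e^{-zs}f$ and its
derivative are both integrable. -/
theorem laplace_of_hasDerivAt {f f' : ℝ → ℝ} (hd : ∀ s, HasDerivAt f (f' s) s) {z : ℂ}
    (hf : LaplaceConvergent f z) (hf' : LaplaceConvergent f' z) :
    laplace f' z = z * laplace f z - f 0 := by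
  have hD : ∀ s : ℝ, HasDerivAt (fun s : ℝ => Complex.exp (-z * s) * (f s : ℂ))
      (-z * (Complex.exp (-z * s) * (f s : ℂ)) + Complex.exp (-z * s) * (f' s : ℂ)) s := by
    intro s
    have h1 : HasDerivAt (fun s : ℝ => -z * (s : ℂ)) (-z) s := by
      simpa using (Complex.ofRealCLM.hasDerivAt (x := s)).const_mul (-z)
    refine (h1.cexp.mul (hd s).ofReal_comp).congr_deriv ?_
    ring
  have hi : IntegrableOn (fun s : ℝ => -z * (Complex.exp (-z * s) * (f s : ℂ)) +
      Complex.exp (-z * s) * (f' s : ℂ)) (Set.Ioi 0) :=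
    (Integrable.const_mul hf (-z)).add hf'
  have ht := tendsto_zero_of_hasDerivAt_of_integrableOn_Ioi (fun s _ => hD s) hi hf
  have h := integral_Ioi_of_hasDerivAt_of_tendsto (a := (0 : ℝ))
    (hD 0).continuousAt.continuousWithinAt (fun s _ => hD s) hi ht
  rw [integral_add (Integrable.const_mul hf (-z)) hf', integral_const_mul] at h
  simp only [Complex.ofReal_zero, mul_zero, Complex.exp_zero, one_mul, zero_sub] at h
  unfold laplace
  linear_combination h

theorem laplaceConvergent_pow_div_factorial (ℓ : ℕ) {z : ℂ} (hz : 0 < z.re) :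
    LaplaceConvergent (fun s => s ^ ℓ / (ℓ.factorial : ℝ)) z := by
  refine laplaceConvergent_of_abs_le_pow (N := ℓ) (by fun_prop) (fun s hs => ?_) hz
  rw [abs_of_nonneg (by positivity)]
  refine div_le_self (by positivity) ?_
  exact_mod_cast Nat.one_le_iff_ne_zero.2 ℓ.factorial_ne_zero

theorem laplace_pow_div_factorial (ℓ : ℕ) {z : ℂ} (hz : 0 < z.re) :
    laplace (fun s => s ^ ℓ / (ℓ.factorial : ℝ)) z = (z ^ (ℓ + 1))⁻¹ := by
  have hz0 : z ≠ 0 := by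
    rintro rfl
    simp at hz
  induction ℓ with
  | zero =>
    have h := laplace_of_hasDerivAt (f := fun s => s ^ 0 / ((Nat.factorial 0 : ℕ) : ℝ))
      (f' := fun _ => 0) (z := z) (fun s => by simpa using hasDerivAt_const s (1 : ℝ))
      (laplaceConvergent_pow_div_factorial 0 hz)
      (by simp [LaplaceConvergent])
    have h0 : laplace (fun _ => 0) z = 0 := by simp [laplace]
    rw [h0] at h
    simp only [pow_zero, Nat.factorial_zero, Nat.cast_one, div_one, Complex.ofReal_one] at h ⊢
    rw [zero_add, pow_one]
    exact eq_inv_of_mul_eq_one_right (by linear_combination -h)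
  | succ ℓ ih =>
    have hd : ∀ s : ℝ, HasDerivAt (fun s : ℝ => s ^ (ℓ + 1) / ((ℓ + 1).factorial : ℝ))
        (s ^ ℓ / (ℓ.factorial : ℝ)) s := by
      intro s
      refine ((hasDerivAt_pow (ℓ + 1) s).div_const _).congr_deriv ?_
      rw [Nat.factorial_succ]
      push_cast
      field_simp
    have h := laplace_of_hasDerivAt hd (laplaceConvergent_pow_div_factorial (ℓ + 1) hz)
      (laplaceConvergent_pow_div_factorial ℓ hz)
    rw [ih] at h
    simp only [ne_eq, Nat.succ_ne_zero, not_false_eq_true, zero_pow, zero_div,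
      Complex.ofReal_zero, sub_zero] at h
    rw [pow_succ z (ℓ + 1), mul_inv, h]
    field_simp

theorem laplaceConvergent_scaledPhi {m : ℕ} {B : Matrix (Fin m) (Fin m) ℝ} {a : ℝ}
    (hB : CoerciveBy B a) (ha : 0 ≤ a) (ℓ : ℕ) (i j : Fin m) {z : ℂ} (hz : 0 < z.re) :
    LaplaceConvergent (fun s => scaledPhi ℓ B s i j) z :=
  laplaceConvergent_of_abs_le_pow (continuous_scaledPhi ℓ B i j)
    (fun _ hs => abs_scaledPhi_le hB ha ℓ hs i j) hz

theorem laplaceConvergent_forcing (ℓ : ℕ) {z : ℂ} (hz : 0 < z.re) :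
    LaplaceConvergent (forcing ℓ) z := by
  cases ℓ with
  | zero =>
    show LaplaceConvergent (fun _ => 0) z
    simp [LaplaceConvergent]
  | succ ℓ => exact laplaceConvergent_pow_div_factorial ℓ hz

/-- The Laplace transform of a column of `s ^ ℓ φ_ℓ(-sB)` solves `(z + B) X = z ^ (-ℓ) e_j`. -/
theorem mulVec_laplace_scaledPhi {m : ℕ} {B : Matrix (Fin m) (Fin m) ℝ} {a : ℝ}
    (hB : CoerciveBy B a) (ha : 0 ≤ a) (ℓ : ℕ) (j : Fin m) {z : ℂ} (hz : 0 < z.re) :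
    (Matrix.scalar (Fin m) z + B.map (fun s : ℝ => (s : ℂ))).mulVec
      (fun i => laplace (fun s => scaledPhi ℓ B s i j) z) = Pi.single j (z ^ ℓ)⁻¹ := by
  have hc := fun i => laplaceConvergent_scaledPhi hB ha ℓ i j hz
  have hfun : ∀ i, (fun s : ℝ => Complex.exp (-z * s) *
      ((-(B * scaledPhi ℓ B s) i j + forcing ℓ s * (1 : Matrix (Fin m) (Fin m) ℝ) i j : ℝ) : ℂ)) =
      fun s : ℝ => -(∑ l, (B i l : ℂ) * (Complex.exp (-z * s) * (scaledPhi ℓ B s l j : ℂ))) +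
        (((1 : Matrix (Fin m) (Fin m) ℝ) i j : ℝ) : ℂ) *
          (Complex.exp (-z * s) * (forcing ℓ s : ℂ)) := by
    intro i
    ext s
    rw [Matrix.mul_apply]
    push_cast
    rw [mul_add, mul_neg, Finset.mul_sum]
    congr 1
    · congr 1
      exact Finset.sum_congr rfl fun l _ => by ring
    · ring
  have hsum : ∀ i, IntegrableOn (fun s : ℝ => ∑ l, (B i l : ℂ) *
      (Complex.exp (-z * s) * (scaledPhi ℓ B s l j : ℂ))) (Set.Ioi 0) := fun i =>
    integrable_finsetSum _ fun l _ => Integrable.const_mul (hc l) _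
  have hneg : ∀ i, IntegrableOn (fun s : ℝ => -∑ l, (B i l : ℂ) *
      (Complex.exp (-z * s) * (scaledPhi ℓ B s l j : ℂ))) (Set.Ioi 0) := fun i => (hsum i).neg
  have hforc := fun i => Integrable.const_mul (laplaceConvergent_forcing ℓ hz)
    ((((1 : Matrix (Fin m) (Fin m) ℝ) i j : ℝ) : ℂ))
  have key : ∀ i, -(∑ l, (B i l : ℂ) * laplace (fun s => scaledPhi ℓ B s l j) z) +
      (((1 : Matrix (Fin m) (Fin m) ℝ) i j : ℝ) : ℂ) * laplace (forcing ℓ) z =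
      z * laplace (fun s => scaledPhi ℓ B s i j) z - (scaledPhi ℓ B 0 i j : ℝ) := by
    intro i
    rw [← laplace_of_hasDerivAt (fun s => hasDerivAt_scaledPhi ℓ B s i j) (hc i)]
    · simp only [laplace]
      rw [hfun i, integral_add (hneg i) (hforc i), integral_neg,
        integral_finsetSum _ fun l _ => Integrable.const_mul (hc l) _]
      simp only [integral_const_mul]
    · unfold LaplaceConvergent
      rw [hfun i]
      exact (hneg i).add (hforc i)
  ext i
  have hk := key i
  have hN : (Matrix.scalar (Fin m) z + B.map (fun s : ℝ => (s : ℂ))).mulVec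
      (fun i => laplace (fun s => scaledPhi ℓ B s i j) z) i =
      z * laplace (fun s => scaledPhi ℓ B s i j) z +
        ∑ l, (B i l : ℂ) * laplace (fun s => scaledPhi ℓ B s l j) z := by
    rw [Matrix.add_mulVec, Pi.add_apply]
    simp [Matrix.mulVec, dotProduct, Matrix.diagonal_apply]
  rw [hN]
  have hone : (((1 : Matrix (Fin m) (Fin m) ℝ) i j : ℝ) : ℂ) = if i = j then 1 else 0 := by
    rw [Matrix.one_apply]
    split_ifs <;> simp
  rw [Pi.single_apply]
  -- The right-hand side comes from the initial value $I$ when `ℓ = 0`, and from the transform of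
  -- the source otherwise.
  cases ℓ with
  | zero =>
    have h0 : laplace (forcing 0) z = 0 := by
      unfold laplace
      simp [forcing]
    rw [scaledPhi_at_zero, if_pos rfl, h0, hone] at hk
    rw [pow_zero, inv_one]
    linear_combination -hk
  | succ ℓ =>
    have h0 : laplace (forcing (ℓ + 1)) z = (z ^ (ℓ + 1))⁻¹ := laplace_pow_div_factorial ℓ hz
    rw [scaledPhi_at_zero, if_neg ℓ.succ_ne_zero, h0, hone] at hk
    simp only [Matrix.zero_apply, Complex.ofReal_zero] at hk
    split_ifs with h
    · rw [if_pos h] at hk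
      linear_combination -hk
    · rw [if_neg h] at hk
      linear_combination -hk

/-! ### Cramer's rule for the corner entry -/

theorem norm_det_scalar_add {m : ℕ} (B : Matrix (Fin m) (Fin m) ℝ) (z : ℂ) :
    ‖(Matrix.scalar (Fin m) z + B.map (fun s : ℝ => (s : ℂ))).det‖ =
      ((eigs B).map fun μ => ‖z + μ‖).prod := by
  set Bc := B.map (fun s : ℝ => (s : ℂ)) with hBc
  have h1 := Matrix.eval_charpoly Bc (-z)
  have h2 : Matrix.scalar (Fin m) (-z) - Bc = -(Matrix.scalar (Fin m) z + Bc) := by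
    rw [map_neg]
    abel
  rw [h2, Matrix.det_neg, (IsAlgClosed.splits Bc.charpoly).eval_eq_prod_roots,
    (Matrix.charpoly_monic Bc).leadingCoeff, one_mul] at h1
  have h3 := congrArg norm h1
  rw [norm_mul, norm_pow, norm_neg, norm_one, one_pow, one_mul] at h3
  have h4 := map_multiset_prod (normHom : ℂ →*₀ ℝ) (Bc.charpoly.roots.map fun x => -z - x)
  rw [← h3]
  refine h4.trans ?_
  rw [Multiset.map_map]
  refine congrArg Multiset.prod (Multiset.map_congr rfl fun μ _ => ?_)
  show ‖-z - μ‖ = ‖z + μ‖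
  rw [← norm_neg]
  congr 1
  ring

theorem norm_laplace_corner {n k : ℕ} {A : Matrix (Fin n) (Fin n) ℝ}
    {v : EuclideanSpace ℝ (Fin n)} {a : ℝ} (hk : 1 ≤ k)
    (hB : CoerciveBy (hessenberg A v k) a) (ha : 0 ≤ a) (ℓ : ℕ) {z : ℂ} (hz : 0 < z.re) :
    ((eigs (hessenberg A v k)).map fun μ => ‖z + μ‖).prod *
      ‖laplace (fun s => scaledPhi ℓ (hessenberg A v k) s
        ⟨k - 1, Nat.sub_one_lt_of_lt hk⟩ ⟨0, hk⟩) z‖ =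
      (∏ j ∈ Finset.range (k - 1), arnoldiCoeff A v (j + 1) j) * (‖z‖ ^ ℓ)⁻¹ := by
  obtain ⟨m, rfl⟩ : ∃ m, k = m + 1 := ⟨k - 1, by omega⟩
  set H := hessenberg A v (m + 1) with hH
  set N := Matrix.scalar (Fin (m + 1)) z + H.map (fun s : ℝ => (s : ℂ)) with hN
  set X : Fin (m + 1) → ℂ := fun i => laplace (fun s => scaledPhi ℓ H s i ⟨0, hk⟩) z with hX
  have hsol : N.mulVec X = Pi.single ⟨0, hk⟩ (z ^ ℓ)⁻¹ :=
    mulVec_laplace_scaledPhi hB ha ℓ ⟨0, hk⟩ hz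
  -- Multiplying by the adjugate avoids any appeal to invertibility of `N`.
  have hcramer : N.det • X = N.adjugate.mulVec (Pi.single ⟨0, hk⟩ (z ^ ℓ)⁻¹) := by
    rw [← hsol, Matrix.mulVec_mulVec, Matrix.adjugate_mul, Matrix.smul_mulVec,
      Matrix.one_mulVec]
  have hlast := congrFun hcramer (Fin.last m)
  -- Without its first row and last column, `N` is upper triangular with the subdiagonal of $H_k$ on
  -- its diagonal; $z$ stays strictly above it.
  have htri : (N.submatrix Fin.succ Fin.castSucc).det =
      ((∏ j ∈ Finset.range m, arnoldiCoeff A v (j + 1) j : ℝ) : ℂ) := by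
    have hentry : ∀ i j : Fin m, j ≤ i →
        N.submatrix Fin.succ Fin.castSucc i j = (arnoldiCoeff A v (i + 1) j : ℂ) := by
      intro i j hij
      have hne : i.succ ≠ j.castSucc := by
        intro h
        have := congrArg Fin.val h
        simp only [Fin.val_succ, Fin.val_castSucc] at this
        have : j.1 ≤ i.1 := hij
        omega
      simp [hN, hH, hessenberg, Matrix.diagonal_apply_ne _ hne]
    rw [Matrix.det_of_isUpperTriangular]
    · rw [← Fin.prod_univ_eq_prod_range (fun j => arnoldiCoeff A v (j + 1) j)]
      push_cast
      exact Finset.prod_congr rfl fun i _ => hentry i i le_rfl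
    · intro i j hij
      have hij' : j < i := hij
      rw [hentry i j hij'.le, arnoldiCoeff_of_lt A v (Nat.succ_lt_succ hij'), Complex.ofReal_zero]
  have hprod : 0 ≤ ∏ j ∈ Finset.range m, arnoldiCoeff A v (j + 1) j :=
    Finset.prod_nonneg fun j _ => by
      rw [arnoldiCoeff_succ]
      exact norm_nonneg _
  have hz' : (⟨0, hk⟩ : Fin (m + 1)) = 0 := rfl
  rw [Pi.smul_apply, smul_eq_mul, Matrix.mulVec_single, hz', Pi.smul_apply] at hlast
  simp only [Matrix.col_apply, Matrix.adjugate_fin_succ_eq_det_submatrix] at hlast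
  rw [Fin.succAbove_zero, Fin.succAbove_last, htri] at hlast
  have hn := congrArg norm hlast
  rw [norm_mul, norm_det_scalar_add] at hn
  have hidx : (⟨m + 1 - 1, Nat.sub_one_lt_of_lt hk⟩ : Fin (m + 1)) = Fin.last m := rfl
  rw [hidx]
  refine hn.trans ?_
  rw [Nat.add_sub_cancel, op_smul_eq_mul, norm_mul, norm_mul, norm_pow, norm_neg,
    norm_one, one_pow, one_mul, Complex.norm_real, Real.norm_of_nonneg hprod, norm_inv, norm_pow]

/-! ### Eigenvalues and the lower bound for the determinant -/

theorem map_conj_eigs {m : ℕ} (B : Matrix (Fin m) (Fin m) ℝ) :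
    (eigs B).map (starRingEnd ℂ) = eigs B := by
  unfold eigs
  rw [← (IsAlgClosed.splits _).roots_map (starRingEnd ℂ)]
  congr 1
  have h : (B.map (fun s : ℝ => (s : ℂ))).charpoly = B.charpoly.map Complex.ofRealHom :=
    Matrix.charpoly_map B Complex.ofRealHom
  rw [h, Polynomial.map_map]
  congr 1
  ext x
  simp

theorem card_eigs {m : ℕ} (B : Matrix (Fin m) (Fin m) ℝ) : (eigs B).card = m := by
  unfold eigs
  rw [IsAlgClosed.card_roots_eq_natDegree, Matrix.charpoly_natDegree_eq_dim, Fintype.card_fin]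

theorem le_re_of_mem_eigs {m : ℕ} {B : Matrix (Fin m) (Fin m) ℝ} {a : ℝ}
    (hB : CoerciveBy B a) {μ : ℂ} (hμ : μ ∈ eigs B) : a ≤ μ.re := by
  have hroot := (Polynomial.mem_roots'.1 hμ).2
  rw [Polynomial.IsRoot.def, Matrix.eval_charpoly] at hroot
  obtain ⟨x, hx, hx0⟩ := Matrix.exists_mulVec_eq_zero_iff.2 hroot
  have heq : ∀ i, ∑ j, (B i j : ℂ) * x j = μ * x i := by
    intro i
    have := congrFun hx0 i
    rw [Matrix.sub_mulVec, Pi.sub_apply, Pi.zero_apply, sub_eq_zero] at this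
    simpa [Matrix.mulVec, dotProduct, Matrix.diagonal_apply] using this.symm
  set p : Fin m → ℝ := fun i => (x i).re with hp
  set q : Fin m → ℝ := fun i => (x i).im with hq
  have hre : ∀ i, B.mulVec p i = μ.re * p i - μ.im * q i := by
    intro i
    have := congrArg Complex.re (heq i)
    simpa [Matrix.mulVec, dotProduct, hp, hq] using this
  have him : ∀ i, B.mulVec q i = μ.re * q i + μ.im * p i := by
    intro i
    have := congrArg Complex.im (heq i)
    simpa [Matrix.mulVec, dotProduct, hp, hq] using this
  -- The terms in `μ.im` cancel when the forms of the real and imaginary parts of the eigenvector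
  -- are added.
  have hsum : p ⬝ᵥ B.mulVec p + q ⬝ᵥ B.mulVec q = μ.re * (p ⬝ᵥ p + q ⬝ᵥ q) := by
    simp only [dotProduct, hre, him, mul_add, Finset.mul_sum, ← Finset.sum_add_distrib]
    exact Finset.sum_congr rfl fun i _ => by ring
  have hpp : 0 ≤ p ⬝ᵥ p := Finset.sum_nonneg fun i _ => mul_self_nonneg (p i)
  have hqq : 0 ≤ q ⬝ᵥ q := Finset.sum_nonneg fun i _ => mul_self_nonneg (q i)
  have hpos : 0 < p ⬝ᵥ p + q ⬝ᵥ q := by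
    refine (add_nonneg hpp hqq).lt_of_ne fun h => hx ?_
    have hp0 := dotProduct_self_eq_zero.1 (by linarith : p ⬝ᵥ p = 0)
    have hq0 := dotProduct_self_eq_zero.1 (by linarith : q ⬝ᵥ q = 0)
    ext i
    exact Complex.ext (congrFun hp0 i) (congrFun hq0 i)
  have := hB p
  have := hB q
  exact le_of_mul_le_mul_right (by linarith) hpos

theorem radius_pos {ε : ℝ} (hε : 0 < ε) {μ : ℂ} (hμ : 0 ≤ μ.re) : 0 < radius ε μ :=
  Real.sqrt_pos.2 (by positivity)

theorem sq_radius (ε : ℝ) (μ : ℂ) : radius ε μ ^ 2 = (ε + μ.re) ^ 2 + μ.im ^ 2 :=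
  Real.sq_sqrt (by positivity)

/-- The factorwise lower bound for a pair of conjugate eigenvalues. -/
theorem sq_le_norm_add_mul_norm_add_conj {ε : ℝ} (hε : 0 < ε) (ρ : ℝ) {μ : ℂ}
    (hμ : 0 ≤ μ.re) :
    (Real.sqrt (radius ε μ * (ε + μ.re)) *
      (1 + ρ ^ 2 / radius ε μ ^ 2) ^ (if μ.im = 0 then (1 / 2 : ℝ) else (1 / 4 : ℝ))) ^ 2 ≤
      ‖(ε : ℂ) + ρ * Complex.I + μ‖ * ‖(ε : ℂ) + ρ * Complex.I + (starRingEnd ℂ) μ‖ := by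
  have hr := radius_pos hε hμ
  have hr2 := sq_radius ε μ
  set r := radius ε μ with hrdef
  have hc : 0 < ε + μ.re := by linarith
  have hbase : 0 ≤ 1 + ρ ^ 2 / r ^ 2 := by positivity
  have hn1 : ‖(ε : ℂ) + ρ * Complex.I + μ‖ ^ 2 = (ε + μ.re) ^ 2 + (ρ + μ.im) ^ 2 := by
    rw [← Complex.normSq_eq_norm_sq, Complex.normSq_apply]
    simp
    ring
  have hn2 : ‖(ε : ℂ) + ρ * Complex.I + (starRingEnd ℂ) μ‖ ^ 2 =
      (ε + μ.re) ^ 2 + (ρ - μ.im) ^ 2 := by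
    rw [← Complex.normSq_eq_norm_sq, Complex.normSq_apply]
    simp
    ring
  have hexp : ((1 + ρ ^ 2 / r ^ 2) ^ (if μ.im = 0 then (1 / 2 : ℝ) else (1 / 4 : ℝ))) ^ 2 =
      if μ.im = 0 then 1 + ρ ^ 2 / r ^ 2 else Real.sqrt (1 + ρ ^ 2 / r ^ 2) := by
    rw [← Real.rpow_natCast, ← Real.rpow_mul hbase]
    split_ifs
    · norm_num
    · rw [Real.sqrt_eq_rpow]
      norm_num
  rw [mul_pow, Real.sq_sqrt (by positivity), hexp]
  refine le_of_sq_le_sq ?_ (by positivity)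
  rw [mul_pow, mul_pow, mul_pow, hn1, hn2]
  split_ifs with him
  · rw [him] at hr2 ⊢
    have h1 : r ^ 2 * (ε + μ.re) ^ 2 * (1 + ρ ^ 2 / r ^ 2) ^ 2 =
        (ε + μ.re) ^ 2 / r ^ 2 * (r ^ 2 + ρ ^ 2) ^ 2 := by
      field_simp
    rw [h1, hr2]
    have : (ε + μ.re) ^ 2 / ((ε + μ.re) ^ 2 + 0 ^ 2) = 1 := by
      rw [zero_pow two_ne_zero, add_zero]
      exact div_self (by positivity)
    rw [this]
    apply le_of_eq
    ring
  · rw [Real.sq_sqrt hbase]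
    have h1 : r ^ 2 * (ε + μ.re) ^ 2 * (1 + ρ ^ 2 / r ^ 2) =
        (ε + μ.re) ^ 2 * (r ^ 2 + ρ ^ 2) := by
      field_simp
    rw [h1, hr2]
    -- With $c=\varepsilon+\operatorname{Re}\mu$, $b=\operatorname{Im}\mu$, the product of squared
    -- norms is $c^4+2c^2(b^2+\rho^2)+(b^2-\rho^2)^2$, to be compared with $c^2(c^2+b^2+\rho^2)$.
    nlinarith [mul_nonneg (sq_nonneg (ε + μ.re)) (add_nonneg (sq_nonneg μ.im) (sq_nonneg ρ)),
      sq_nonneg (μ.im ^ 2 - ρ ^ 2)]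

/-- The bound fails for a single non-real factor, e.g. at $\rho=-\operatorname{Im}\mu$. So the
product is squared and one copy is reindexed by conjugation, which makes a factorwise comparison
possible. -/
theorem omega_mul_varsigma_le {m : ℕ} {B : Matrix (Fin m) (Fin m) ℝ} {a : ℝ}
    (hB : CoerciveBy B a) (ha : 0 ≤ a) {ε : ℝ} (hε : 0 < ε) (ρ : ℝ) :
    omega B ε * varsigma B ε ρ ≤
      ((eigs B).map fun μ => ‖(ε : ℂ) + ρ * Complex.I + μ‖).prod := by
  refine le_of_sq_le_sq ?_ (Multiset.prod_nonneg fun x hx => by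
    obtain ⟨μ, _, rfl⟩ := Multiset.mem_map.1 hx
    exact norm_nonneg _)
  have hconj : ((eigs B).map fun μ => ‖(ε : ℂ) + ρ * Complex.I + (starRingEnd ℂ) μ‖).prod =
      ((eigs B).map fun μ => ‖(ε : ℂ) + ρ * Complex.I + μ‖).prod := by
    conv_rhs => rw [← map_conj_eigs B, Multiset.map_map]
    rfl
  rw [omega, varsigma, ← Multiset.prod_map_mul, ← Multiset.prod_map_pow,
    sq (Multiset.prod _)]
  nth_rewrite 2 [← hconj]
  rw [← Multiset.prod_map_mul]
  exact Multiset.prod_map_le_prod_map₀ _ _ (fun _ _ => sq_nonneg _) fun μ hμ =>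
    sq_le_norm_add_mul_norm_add_conj hε ρ (ha.trans (le_re_of_mem_eigs hB hμ))

/-! ### Inversion of the Laplace transform -/

open FourierTransform in
/-- A function whose Laplace transform is dominated by an integrable even function on a vertical
line is bounded through the inversion formula. -/
theorem abs_le_of_norm_laplace_le {x : ℝ → ℝ} (hx : Continuous x) (hx0 : x 0 = 0) {ε : ℝ}
    (hconv : LaplaceConvergent x ε) {F : ℝ → ℝ} (hF : Integrable F) (heven : ∀ ρ, F |ρ| = F ρ)
    (hb : ∀ ρ : ℝ, ‖laplace x (ε + ρ * Complex.I)‖ ≤ F ρ) {s : ℝ} (hs : 0 ≤ s) :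
    |x s| ≤ Real.exp (ε * s) * (Real.pi⁻¹ * ∫ ρ in Set.Ioi (0 : ℝ), F ρ) := by
  -- Since $x(0)=0$, this is the extension by zero to $s<0$ and is continuous, as pointwise
  -- inversion requires.
  set G : ℝ → ℂ := fun s => Complex.exp (-ε * s) * (x (max s 0) : ℂ) with hG
  have hGc : Continuous G := by
    have := hx.comp (continuous_id.max continuous_const : Continuous fun s : ℝ => max s 0)
    exact Continuous.mul (by fun_prop) (Complex.continuous_ofReal.comp this)
  have hGi : G = (Set.Ioi (0 : ℝ)).indicator
      (fun s : ℝ => Complex.exp (-ε * s) * (x s : ℂ)) := by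
    ext s
    rcases lt_or_ge 0 s with h | h
    · rw [Set.indicator_of_mem (Set.mem_Ioi.2 h)]
      simp [hG, max_eq_left h.le]
    · rw [Set.indicator_of_notMem (by simpa using h)]
      simp [hG, max_eq_right h, hx0]
  have hGint : Integrable G := by
    rw [hGi, integrable_indicator_iff measurableSet_Ioi]
    exact hconv
  have hfour : ∀ w : ℝ, 𝓕 G w = laplace x (ε + ((2 * Real.pi * w : ℝ) : ℂ) * Complex.I) := by
    intro w
    rw [Real.fourier_real_eq_integral_exp_smul, laplace, ← integral_indicator measurableSet_Ioi]
    congr 1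
    ext u
    rw [hGi]
    by_cases hu : u ∈ Set.Ioi (0 : ℝ)
    · rw [Set.indicator_of_mem hu, Set.indicator_of_mem hu, smul_eq_mul, ← mul_assoc,
        ← Complex.exp_add]
      congr 2
      push_cast
      ring
    · rw [Set.indicator_of_notMem hu, Set.indicator_of_notMem hu, smul_zero]
  have hπ : (2 * Real.pi) ≠ 0 := by positivity
  have hbd : ∀ w, ‖𝓕 G w‖ ≤ F (2 * Real.pi * w) := fun w => by
    rw [hfour]
    exact hb _
  have hFi : Integrable fun w => F (2 * Real.pi * w) := hF.comp_mul_left' hπ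
  have hcont : Continuous (𝓕 G) :=
    VectorFourier.fourierIntegral_continuous Real.continuous_fourierChar
      (by exact continuous_inner) hGint
  have hfint : Integrable (𝓕 G) :=
    hFi.mono' hcont.aestronglyMeasurable (Filter.Eventually.of_forall hbd)
  have hinv := hGint.fourierInv_fourier_eq hfint (v := s) hGc.continuousAt
  have hGs : ‖G s‖ ≤ ∫ w, F (2 * Real.pi * w) := by
    rw [← hinv, Real.fourierInv_eq']
    refine (norm_integral_le_integral_norm _).trans (integral_mono ?_ hFi fun w => ?_)
    · simp only [norm_smul, Complex.norm_exp_ofReal_mul_I, one_mul]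
      exact hfint.norm
    · simp only [norm_smul, Complex.norm_exp_ofReal_mul_I, one_mul]
      exact hbd w
  -- The frequency scaling contributes $1/(2\pi)$ and evenness a factor $2$, giving $1/\pi$.
  have hIF : ∫ w, F (2 * Real.pi * w) = Real.pi⁻¹ * ∫ ρ in Set.Ioi (0 : ℝ), F ρ := by
    rw [Measure.integral_comp_mul_left F (2 * Real.pi), abs_of_pos (by positivity), smul_eq_mul]
    have := integral_comp_abs (f := F)
    simp only [heven] at this
    rw [this, mul_inv]
    ring
  rw [hIF] at hGs
  have hn : ‖G s‖ = Real.exp (-(ε * s)) * |x s| := by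
    simp [hG, Complex.norm_exp, max_eq_left hs]
  rw [hn, Real.exp_neg, ← div_eq_inv_mul, div_le_iff₀ (Real.exp_pos _)] at hGs
  linarith

/-! ### Positivity and integrability of the majorant -/

section Integrand

variable {m : ℕ} {B : Matrix (Fin m) (Fin m) ℝ} {a ε : ℝ}

theorem omega_pos (hB : CoerciveBy B a) (ha : 0 ≤ a) (hε : 0 < ε) : 0 < omega B ε := by
  refine Multiset.prod_pos fun x hx => ?_
  obtain ⟨μ, hμ, rfl⟩ := Multiset.mem_map.1 hx
  have hre := ha.trans (le_re_of_mem_eigs hB hμ)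
  exact Real.sqrt_pos.2 (mul_pos (radius_pos hε hre) (by linarith))

theorem varsigma_pos (B : Matrix (Fin m) (Fin m) ℝ) (ε ρ : ℝ) : 0 < varsigma B ε ρ := by
  refine Multiset.prod_pos fun x hx => ?_
  obtain ⟨μ, -, rfl⟩ := Multiset.mem_map.1 hx
  exact Real.rpow_pos_of_pos (by positivity) _

theorem continuous_varsigma (B : Matrix (Fin m) (Fin m) ℝ) (ε : ℝ) :
    Continuous (varsigma B ε) := by
  unfold varsigma
  refine continuous_multiset_prod _ fun μ _ => ?_
  refine Continuous.rpow_const (by fun_prop) fun ρ => Or.inl ?_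
  positivity

theorem continuous_errorIntegrand (B : Matrix (Fin m) (Fin m) ℝ) (ℓ : ℕ) (ε : ℝ) :
    Continuous (errorIntegrand B ℓ ε) := by
  unfold errorIntegrand
  refine Continuous.div ?_ (continuous_varsigma B ε) fun ρ => (varsigma_pos B ε ρ).ne'
  refine Continuous.rpow_const (by fun_prop) fun ρ => Or.inl ?_
  positivity

theorem errorIntegrand_nonneg (B : Matrix (Fin m) (Fin m) ℝ) (ℓ : ℕ) (ε ρ : ℝ) :
    0 ≤ errorIntegrand B ℓ ε ρ :=
  div_nonneg (by positivity) (varsigma_pos B ε ρ).le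

theorem errorIntegrand_abs (B : Matrix (Fin m) (Fin m) ℝ) (ℓ : ℕ) (ε ρ : ℝ) :
    errorIntegrand B ℓ ε |ρ| = errorIntegrand B ℓ ε ρ := by
  simp only [errorIntegrand, varsigma, sq_abs]

/-- With all radii enlarged to a common $R$, the exponents $1/2$ (real) and $1/4$ (non-real) add up
to $(k+k_1)/4$. -/
theorem rpow_card_le_prod_rpow {ε R : ℝ} (ρ : ℝ) (s : Multiset ℂ)
    (hs : ∀ μ ∈ s, 0 < radius ε μ ∧ radius ε μ ≤ R) :
    (1 + ρ ^ 2 / R ^ 2) ^ (((s.card + s.countP (fun μ => μ.im = 0) : ℕ) : ℝ) / 4) ≤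
      (s.map fun μ =>
        (1 + ρ ^ 2 / radius ε μ ^ 2) ^ (if μ.im = 0 then (1 / 2 : ℝ) else (1 / 4 : ℝ))).prod := by
  induction s using Multiset.induction with
  | empty => simp
  | cons μ s ih =>
    have hbase : 0 < 1 + ρ ^ 2 / R ^ 2 := by positivity
    have hexp : (((μ ::ₘ s).card + (μ ::ₘ s).countP (fun μ => μ.im = 0) : ℕ) : ℝ) / 4 =
        (if μ.im = 0 then (1 / 2 : ℝ) else (1 / 4 : ℝ)) +
          ((s.card + s.countP (fun μ => μ.im = 0) : ℕ) : ℝ) / 4 := by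
      rw [Multiset.card_cons, Multiset.countP_cons]
      split_ifs <;> push_cast <;> ring
    rw [hexp, Real.rpow_add hbase, Multiset.map_cons, Multiset.prod_cons]
    have hμ := hs μ (Multiset.mem_cons_self μ s)
    refine mul_le_mul (Real.rpow_le_rpow hbase.le ?_ (by split_ifs <;> norm_num))
      (ih fun ν hν => hs ν (Multiset.mem_cons_of_mem hν)) (by positivity) (by positivity)
    have := hμ.1
    have := hμ.2
    gcongr

theorem integrable_errorIntegrand (hB : CoerciveBy B a) (ha : 0 ≤ a) (hε : 0 < ε) {ℓ : ℕ}
    (hcount : 4 ≤ m + realEigCount B + 2 * ℓ) : Integrable (errorIntegrand B ℓ ε) := by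
  obtain ⟨R₀, hR₀⟩ := ((eigs B).toFinset.image (radius ε)).bddAbove
  -- `R` also dominates `ε`, so that the factor with exponent $-\ell/2$ can use the same base; the
  -- total exponent is then at most $-1$.
  set R := max R₀ ε with hR
  have hεR : ε ≤ R := le_max_right _ _
  have hRpos : 0 < R := hε.trans_le hεR
  have hrad : ∀ μ ∈ eigs B, 0 < radius ε μ ∧ radius ε μ ≤ R := fun μ hμ =>
    ⟨radius_pos hε (ha.trans (le_re_of_mem_eigs hB hμ)), le_max_of_le_left (hR₀ (by
      rw [Finset.mem_coe]
      exact Finset.mem_image_of_mem _ (Multiset.mem_toFinset.2 hμ)))⟩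
  refine (integrable_inv_one_add_sq.comp_div hRpos.ne').mono'
    (continuous_errorIntegrand B ℓ ε).aestronglyMeasurable (Filter.Eventually.of_forall fun ρ => ?_)
  rw [Real.norm_of_nonneg (errorIntegrand_nonneg B ℓ ε ρ), div_pow]
  set b := 1 + ρ ^ 2 / R ^ 2 with hb
  have hb1 : 1 ≤ b := by
    have : 0 ≤ ρ ^ 2 / R ^ 2 := by positivity
    linarith
  have hb0 : 0 < b := by linarith
  have h1 : (1 + ρ ^ 2 / ε ^ 2) ^ (-(ℓ : ℝ) / 2) ≤ b ^ (-(ℓ : ℝ) / 2) := by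
    refine Real.rpow_le_rpow_of_nonpos hb0 ?_ ?_
    · rw [hb]
      gcongr
    · have : (0 : ℝ) ≤ ℓ := ℓ.cast_nonneg
      linarith
  have h2 := rpow_card_le_prod_rpow ρ (eigs B) hrad
  rw [card_eigs] at h2
  calc errorIntegrand B ℓ ε ρ
      ≤ b ^ (-(ℓ : ℝ) / 2) / b ^ (((m + realEigCount B : ℕ) : ℝ) / 4) :=
        div_le_div₀ (by positivity) h1 (by positivity) h2
    _ = b ^ (-(ℓ : ℝ) / 2 - ((m + realEigCount B : ℕ) : ℝ) / 4) := (Real.rpow_sub hb0 _ _).symm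
    _ ≤ b ^ (-1 : ℝ) := by
        refine Real.rpow_le_rpow_of_exponent_le hb1 ?_
        have : (4 : ℝ) ≤ ((m + realEigCount B : ℕ) : ℝ) + 2 * ℓ := by exact_mod_cast hcount
        linarith
    _ = b⁻¹ := Real.rpow_neg_one b

end Integrand

/-! ### The bound for the corner entry -/

section Corner

variable {n k : ℕ} {A : Matrix (Fin n) (Fin n) ℝ} {v : EuclideanSpace ℝ (Fin n)} {a ε : ℝ}

theorem norm_laplace_corner_le (hk : 1 ≤ k) (hB : CoerciveBy (hessenberg A v k) a) (ha : 0 ≤ a)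
    (hε : 0 < ε) (ℓ : ℕ) (ρ : ℝ) :
    ‖laplace (fun s => scaledPhi ℓ (hessenberg A v k) s
        ⟨k - 1, Nat.sub_one_lt_of_lt hk⟩ ⟨0, hk⟩) (ε + ρ * Complex.I)‖ ≤
      (∏ j ∈ Finset.range (k - 1), arnoldiCoeff A v (j + 1) j) /
        (ε ^ ℓ * omega (hessenberg A v k) ε) * errorIntegrand (hessenberg A v k) ℓ ε ρ := by
  set z : ℂ := ε + ρ * Complex.I with hz
  have hzre : 0 < z.re := by simpa [hz] using hε
  have hmain := norm_laplace_corner (A := A) (v := v) hk hB ha ℓ hzre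
  have hlow := omega_mul_varsigma_le hB ha hε ρ
  have hω := omega_pos hB ha hε
  have hς := varsigma_pos (hessenberg A v k) ε ρ
  have hP : 0 ≤ ∏ j ∈ Finset.range (k - 1), arnoldiCoeff A v (j + 1) j :=
    Finset.prod_nonneg fun j _ => by
      rw [arnoldiCoeff_succ]
      exact norm_nonneg _
  have hnz : ‖z‖ ^ ℓ = ε ^ ℓ * (1 + ρ ^ 2 / ε ^ 2) ^ ((ℓ : ℝ) / 2) := by
    have h1 : ‖z‖ = ε * Real.sqrt (1 + ρ ^ 2 / ε ^ 2) := by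
      rw [hz, Complex.norm_add_mul_I, show ε ^ 2 + ρ ^ 2 = ε ^ 2 * (1 + ρ ^ 2 / ε ^ 2) by
        field_simp, Real.sqrt_mul (by positivity), Real.sqrt_sq hε.le]
    rw [h1, mul_pow, Real.sqrt_eq_rpow, ← Real.rpow_mul_natCast (by positivity)]
    congr 2
    ring
  have hint : errorIntegrand (hessenberg A v k) ℓ ε ρ =
      ((1 + ρ ^ 2 / ε ^ 2) ^ ((ℓ : ℝ) / 2))⁻¹ / varsigma (hessenberg A v k) ε ρ := by
    rw [errorIntegrand, neg_div, Real.rpow_neg (by positivity)]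
  have hq : 0 < (1 + ρ ^ 2 / ε ^ 2) ^ ((ℓ : ℝ) / 2) := by positivity
  have h3 := (mul_le_mul_of_nonneg_right hlow (norm_nonneg _)).trans hmain.le
  rw [hnz] at h3
  rw [hint, ← mul_le_mul_iff_right₀ (mul_pos hω hς)]
  refine h3.trans (le_of_eq ?_)
  field_simp

theorem abs_scaledPhi_corner_le (hk : 1 ≤ k) (hB : CoerciveBy (hessenberg A v k) a) (ha : 0 ≤ a)
    (hε : 0 < ε) {ℓ : ℕ} (hcount : 4 ≤ k + realEigCount (hessenberg A v k) + 2 * ℓ) {s : ℝ}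
    (hs : 0 ≤ s) :
    |scaledPhi ℓ (hessenberg A v k) s ⟨k - 1, Nat.sub_one_lt_of_lt hk⟩ ⟨0, hk⟩| ≤
      Real.exp (ε * s) * (Real.pi⁻¹ * ((∏ j ∈ Finset.range (k - 1), arnoldiCoeff A v (j + 1) j) /
        (ε ^ ℓ * omega (hessenberg A v k) ε) *
          ∫ ρ in Set.Ioi (0 : ℝ), errorIntegrand (hessenberg A v k) ℓ ε ρ)) := by
  rw [← integral_const_mul]
  refine abs_le_of_norm_laplace_le (continuous_scaledPhi ℓ _ _ _) ?_
    (laplaceConvergent_scaledPhi hB ha ℓ _ _ (by simpa using hε))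
    ((integrable_errorIntegrand hB ha hε hcount).const_mul _)
    (fun ρ => by rw [errorIntegrand_abs]) (norm_laplace_corner_le hk hB ha hε ℓ) hs
  rw [scaledPhi_at_zero]
  split_ifs with h
  -- For `ℓ = 0` the count together with $k_1\le k$ forces $k\ge2$, so the corner lies off the
  -- diagonal of the initial value $I$.
  · have h1 : realEigCount (hessenberg A v k) ≤ k := by
      have := Multiset.countP_le_card (fun μ : ℂ => μ.im = 0) (eigs (hessenberg A v k))
      rwa [card_eigs] at this
    refine Matrix.one_apply_ne fun h2 => ?_
    have := congrArg Fin.val h2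
    simp only at this
    omega
  · rfl

end Corner

/-! ### The error equation and Duhamel's estimate -/

theorem hasDerivAt_toEuclideanLin {n : ℕ} {M : ℝ → Matrix (Fin n) (Fin n) ℝ}
    {M' : Matrix (Fin n) (Fin n) ℝ} {y : ℝ → EuclideanSpace ℝ (Fin n)}
    {y' : EuclideanSpace ℝ (Fin n)} {s : ℝ}
    (hM : ∀ i j, HasDerivAt (fun u => M u i j) (M' i j) s) (hy : HasDerivAt y y' s) :
    HasDerivAt (fun u => Matrix.toEuclideanLin (M u) (y u))
      (Matrix.toEuclideanLin M' (y s) + Matrix.toEuclideanLin (M s) y') s := by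
  let L := PiLp.continuousLinearEquiv 2 ℝ (fun _ : Fin n => ℝ)
  have hyi : ∀ j, HasDerivAt (fun u => y u j) (y' j) s :=
    hasDerivAt_pi.1 (L.hasFDerivAt.comp_hasDerivAt s hy)
  have h : HasDerivAt (fun u i => ∑ j, M u i j * y u j)
      (fun i => ∑ j, (M' i j * y s j + M s i j * y' j)) s :=
    hasDerivAt_pi.2 fun i => HasDerivAt.fun_sum fun j _ => (hM i j).mul (hyi j)
  refine (L.symm.hasFDerivAt.comp_hasDerivAt s h).congr_deriv ?_
  ext i
  simp [L, Matrix.toLpLin_apply, Matrix.mulVec, dotProduct, Finset.sum_add_distrib]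

theorem norm_exp_neg_smul_le {n : ℕ} {A : Matrix (Fin n) (Fin n) ℝ} {a : ℝ}
    (hA : CoerciveBy A a) {s : ℝ} (hs : 0 ≤ s) (y : EuclideanSpace ℝ (Fin n)) :
    ‖Matrix.toEuclideanLin (exp ((-s) • A)) y‖ ≤ Real.exp (-(a * s)) * ‖y‖ := by
  refine le_of_sq_le_sq ?_ (by positivity)
  have h := exp_neg_smul_mulVec_dotProduct_le hA hs y.ofLp
  rw [mul_pow, ← real_inner_self_eq_norm_sq, ← real_inner_self_eq_norm_sq, inner_eq_dotProduct,
    inner_eq_dotProduct, ← Real.exp_nat_mul,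
    show ((2 : ℕ) : ℝ) * -(a * s) = -(2 * a * s) by push_cast; ring]
  exact h

section Error

variable {n k : ℕ} {A : Matrix (Fin n) (Fin n) ℝ} {v : EuclideanSpace ℝ (Fin n)}

/-- The error multiplied by `s ^ ℓ`, which extends smoothly to `s = 0`. -/
noncomputable def scaledError (A : Matrix (Fin n) (Fin n) ℝ) (v : EuclideanSpace ℝ (Fin n))
    (ℓ : ℕ) (hk : 1 ≤ k) (s : ℝ) : EuclideanSpace ℝ (Fin n) :=
  Matrix.toEuclideanLin (scaledPhi ℓ A s) v -
    ‖v‖ • arnoldiComb A v (fun j => scaledPhi ℓ (hessenberg A v k) s j ⟨0, hk⟩)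

theorem scaledError_eq (ℓ : ℕ) (hk : 1 ≤ k) (s : ℝ) :
    scaledError A v ℓ hk s = s ^ ℓ • arnoldiError A v ℓ hk s := by
  have h : (fun j => scaledPhi ℓ (hessenberg A v k) s j ⟨0, hk⟩) =
      s ^ ℓ • fun j => phi ℓ ((-s) • hessenberg A v k) j ⟨0, hk⟩ := rfl
  rw [scaledError, arnoldiError, exactSol, arnoldiApprox_eq, smul_sub, h, arnoldiComb_smul,
    smul_comm, scaledPhi, map_smul, LinearMap.smul_apply]

theorem scaledError_zero (ℓ : ℕ) (hk : 1 ≤ k) (hv : v ≠ 0) : scaledError A v ℓ hk 0 = 0 := by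
  cases ℓ with
  | zero =>
    have h : (fun j => scaledPhi 0 (hessenberg A v k) 0 j ⟨0, hk⟩) = Pi.single ⟨0, hk⟩ 1 := by
      ext j
      rw [scaledPhi_at_zero, if_pos rfl, Matrix.one_apply, Pi.single_apply]
    rw [scaledError, h, norm_smul_arnoldiComb_single A hk hv, scaledPhi_at_zero, if_pos rfl,
      sub_eq_zero]
    ext i
    simp
  | succ ℓ => rw [scaledError_eq, zero_pow ℓ.succ_ne_zero, zero_smul]

/-- The sources cancel because $\beta V_k\mathbf e_1=\mathbf v$, leaving only the Arnoldi defect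
along $w_k$. -/
theorem hasDerivAt_scaledError (ℓ : ℕ) (hk : 1 ≤ k) (hv : v ≠ 0)
    (hA : ∀ j : ℕ, j + 1 < k → arnoldiCoeff A v (j + 1) j ≠ 0) (s : ℝ) :
    HasDerivAt (scaledError A v ℓ hk)
      (-Matrix.toEuclideanLin A (scaledError A v ℓ hk s) -
        (‖v‖ * scaledPhi ℓ (hessenberg A v k) s ⟨k - 1, Nat.sub_one_lt_of_lt hk⟩ ⟨0, hk⟩) •
          arnoldiNext A v (k - 1)) s := by
  set H := hessenberg A v k with hH
  set x : ℝ → Fin k → ℝ := fun s j => scaledPhi ℓ H s j ⟨0, hk⟩ with hx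
  have h1 : HasDerivAt (fun u => Matrix.toEuclideanLin (scaledPhi ℓ A u) v)
      (-Matrix.toEuclideanLin A (Matrix.toEuclideanLin (scaledPhi ℓ A s) v) +
        forcing ℓ s • v) s := by
    have h := hasDerivAt_toEuclideanLin (M' := -(A * scaledPhi ℓ A s) + forcing ℓ s • 1)
      (fun i j => hasDerivAt_scaledPhi ℓ A s i j) (hasDerivAt_const s v)
    refine h.congr_deriv ?_
    ext i
    simp [Matrix.toLpLin_apply]
  have h2 : HasDerivAt (fun u => ‖v‖ • arnoldiComb A v (x u))
      (‖v‖ • arnoldiComb A v ((-1 : ℝ) • H.mulVec (x s) +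
        forcing ℓ s • Pi.single ⟨0, hk⟩ 1)) s := by
    have h : HasDerivAt (fun u => ‖v‖ • arnoldiComb A v (x u))
        (‖v‖ • arnoldiComb A v (fun j => -(H * scaledPhi ℓ H s) j ⟨0, hk⟩ +
          forcing ℓ s * (1 : Matrix (Fin k) (Fin k) ℝ) j ⟨0, hk⟩)) s := by
      simp only [arnoldiComb]
      exact (HasDerivAt.fun_sum fun j _ =>
        (hasDerivAt_scaledPhi ℓ H s j ⟨0, hk⟩).smul_const _).const_smul ‖v‖
    convert h using 3
    ext j
    simp only [Pi.add_apply, Pi.smul_apply, smul_eq_mul, Matrix.one_apply, Pi.single_apply]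
    rw [Matrix.mul_apply]
    simp only [Matrix.mulVec, dotProduct, hx]
    ring
  refine (h1.sub h2).congr_deriv ?_
  have hcol := toEuclideanLin_arnoldiComb A hk hA (x s)
  have hsv : forcing ℓ s • v = forcing ℓ s • ‖v‖ •
      arnoldiComb A v (Pi.single (⟨0, hk⟩ : Fin k) 1) := by
    rw [norm_smul_arnoldiComb_single A hk hv]
  have hE : scaledError A v ℓ hk s =
      Matrix.toEuclideanLin (scaledPhi ℓ A s) v - ‖v‖ • arnoldiComb A v (x s) := rfl
  have hxk : scaledPhi ℓ H s ⟨k - 1, Nat.sub_one_lt_of_lt hk⟩ ⟨0, hk⟩ =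
      x s ⟨k - 1, Nat.sub_one_lt_of_lt hk⟩ := rfl
  rw [hE, hxk, arnoldiComb_add, arnoldiComb_smul, arnoldiComb_smul, map_sub, map_smul, hcol, hsv]
  module

theorem norm_scaledError_le (ℓ : ℕ) (hk : 1 ≤ k) (hv : v ≠ 0)
    (hA : ∀ j : ℕ, j + 1 < k → arnoldiCoeff A v (j + 1) j ≠ 0) {a ε C t : ℝ}
    (hC : CoerciveBy A a) (hεa : 0 < ε + a) (hC0 : 0 ≤ C) (ht : 0 ≤ t)
    (hcorner : ∀ s, 0 ≤ s →
      |scaledPhi ℓ (hessenberg A v k) s ⟨k - 1, Nat.sub_one_lt_of_lt hk⟩ ⟨0, hk⟩| ≤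
        Real.exp (ε * s) * C) :
    ‖scaledError A v ℓ hk t‖ ≤
      ‖v‖ * ‖arnoldiNext A v (k - 1)‖ * C * Real.exp (t * ε) / (ε + a) := by
  set w := arnoldiNext A v (k - 1) with hw
  set x : ℝ → ℝ := fun s =>
    scaledPhi ℓ (hessenberg A v k) s ⟨k - 1, Nat.sub_one_lt_of_lt hk⟩ ⟨0, hk⟩ with hx
  -- Duhamel's integrating factor: `f` runs from $0$ at $s=0$ to the scaled error at $s=t$, and its
  -- derivative contains only the defect.
  set f : ℝ → EuclideanSpace ℝ (Fin n) := fun s =>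
    Matrix.toEuclideanLin (exp ((s - t) • A)) (scaledError A v ℓ hk s) with hf
  have hfd : ∀ s, HasDerivAt f
      (Matrix.toEuclideanLin (exp ((s - t) • A)) (-((‖v‖ * x s) • w))) s := by
    intro s
    have hM : ∀ i j, HasDerivAt (fun u : ℝ => exp ((u - t) • A) i j)
        ((A * exp ((s - t) • A)) i j) s := fun i j =>
      (hasDerivAt_exp_smul_entry A i j (s - t)).comp_sub_const s t
    refine (hasDerivAt_toEuclideanLin hM
      (hasDerivAt_scaledError ℓ hk hv hA s)).congr_deriv ?_
    rw [map_sub, map_neg, map_neg, ← exp_smul_mul_comm]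
    have : Matrix.toEuclideanLin (exp ((s - t) • A) * A) (scaledError A v ℓ hk s) =
        Matrix.toEuclideanLin (exp ((s - t) • A))
          (Matrix.toEuclideanLin A (scaledError A v ℓ hk s)) := by
      ext i
      simp [Matrix.toLpLin_apply]
    rw [this]
    abel
  set K := ‖v‖ * ‖w‖ * C with hK
  have hK0 : 0 ≤ K := by positivity
  have hBd : ∀ s, HasDerivAt
      (fun s => K * Real.exp (-(a * t)) * ((Real.exp ((ε + a) * s) - 1) / (ε + a)))
      (K * Real.exp (-(a * t)) * Real.exp ((ε + a) * s)) s := by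
    intro s
    have h1 : HasDerivAt (fun s : ℝ => (ε + a) * s) (ε + a) s := by
      simpa using (hasDerivAt_id s).const_mul (ε + a)
    refine (((h1.exp.sub_const 1).div_const (ε + a)).const_mul _).congr_deriv ?_
    field_simp
  have hbound : ∀ s ∈ Set.Ico 0 t,
      ‖Matrix.toEuclideanLin (exp ((s - t) • A)) (-((‖v‖ * x s) • w))‖ ≤
        K * Real.exp (-(a * t)) * Real.exp ((ε + a) * s) := by
    intro s hs
    have h1 := norm_exp_neg_smul_le hC (s := t - s) (by linarith [hs.2]) (-((‖v‖ * x s) • w))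
    rw [neg_sub] at h1
    refine h1.trans ?_
    rw [norm_neg, norm_smul, norm_mul, norm_norm, Real.norm_eq_abs]
    have h2 : ‖v‖ * |x s| * ‖w‖ ≤ K * Real.exp (ε * s) := by
      calc ‖v‖ * |x s| * ‖w‖ ≤ ‖v‖ * (Real.exp (ε * s) * C) * ‖w‖ := by
            gcongr
            exact hcorner s hs.1
        _ = K * Real.exp (ε * s) := by rw [hK]; ring
    refine (mul_le_mul_of_nonneg_left h2 (Real.exp_pos _).le).trans (le_of_eq ?_)
    rw [mul_left_comm, mul_assoc K, ← Real.exp_add, ← Real.exp_add]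
    congr 2
    ring
  have hmain := image_norm_le_of_norm_deriv_right_le_deriv_boundary (f := f) (a := 0) (b := t)
    (fun s _ => (hfd s).continuousAt.continuousWithinAt) (fun s _ => (hfd s).hasDerivWithinAt)
    (by simp [hf, scaledError_zero ℓ hk hv]) hBd hbound (Set.right_mem_Icc.2 ht)
  have hft : f t = scaledError A v ℓ hk t := by
    simp only [hf, sub_self, zero_smul, exp_zero]
    ext i
    simp
  rw [hft] at hmain
  refine hmain.trans ?_
  -- The integrated majorant carries $e^{t\varepsilon}-e^{-at}$; the negative term is dropped.
  rw [mul_div_assoc', div_le_div_iff_of_pos_right hεa, mul_assoc]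
  refine mul_le_mul_of_nonneg_left ?_ hK0
  rw [mul_sub, ← Real.exp_add, mul_one]
  have : -(a * t) + (ε + a) * t = t * ε := by ring
  rw [this]
  linarith [Real.exp_pos (-(a * t))]

end Error

end ArnoldiPhi

/-! ### Assembly of the estimate -/

theorem theorem4p2 (n k ℓ : ℕ) (hk : 1 ≤ k)
    (A : Matrix (Fin n) (Fin n) ℝ) (v : EuclideanSpace ℝ (Fin n)) (hv : v ≠ 0)
    (ϑ a : ℝ) (ha : 0 ≤ a) (hϑ₀ : 0 ≤ ϑ) (hϑ₁ : ϑ ≤ Real.pi / 2)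
    (hW : ArnoldiPhi.numericalRange A ⊆ ArnoldiPhi.sector ϑ a)
    (ε t : ℝ) (hε : 0 < ε) (ht : 0 < t)
    -- the Arnoldi process started at `v` does not break down before step `k`
    (hArnoldi : ∀ j : ℕ, j + 1 < k → ArnoldiPhi.arnoldiCoeff A v (j + 1) j ≠ 0)
    (hcorner : ArnoldiPhi.cornerEntry A v ℓ hk t ≠ 0)
    (hcount : 4 ≤ k + ArnoldiPhi.realEigCount (ArnoldiPhi.hessenberg A v k) + 2 * ℓ) :
    MeasureTheory.IntegrableOn
        (fun ρ : ℝ => ArnoldiPhi.errorIntegrand (ArnoldiPhi.hessenberg A v k) ℓ ε ρ)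
        (Set.Ioi (0 : ℝ)) ∧
      ‖ArnoldiPhi.arnoldiError A v ℓ hk t‖ ≤
        ArnoldiPhi.errorConst A v ℓ hk a ε t *
          (∫ ρ in Set.Ioi (0 : ℝ),
            ArnoldiPhi.errorIntegrand (ArnoldiPhi.hessenberg A v k) ℓ ε ρ) *
          ‖ArnoldiPhi.arnoldiResidual A v ℓ hk t‖ := by
  have hC := ArnoldiPhi.coerciveBy_of_numericalRange hϑ₁ hW
  have hB := hC.hessenberg hk hv hArnoldi
  refine ⟨(ArnoldiPhi.integrable_errorIntegrand hB ha hε hcount).integrableOn, ?_⟩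
  have hω := ArnoldiPhi.omega_pos hB ha hε
  have hεa : 0 < ε + a := by linarith
  have hP : 0 ≤ ∏ j ∈ Finset.range (k - 1), ArnoldiPhi.arnoldiCoeff A v (j + 1) j :=
    Finset.prod_nonneg fun j _ => by
      rw [ArnoldiPhi.arnoldiCoeff_succ]
      exact norm_nonneg _
  have hI : 0 ≤ ∫ ρ in Set.Ioi (0 : ℝ),
      ArnoldiPhi.errorIntegrand (ArnoldiPhi.hessenberg A v k) ℓ ε ρ :=
    integral_nonneg fun ρ => ArnoldiPhi.errorIntegrand_nonneg _ ℓ ε ρ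
  have hmain := ArnoldiPhi.norm_scaledError_le ℓ hk hv hArnoldi hC hεa (by positivity) ht.le
    (fun s hs => ArnoldiPhi.abs_scaledPhi_corner_le hk hB ha hε hcount hs)
  rw [ArnoldiPhi.scaledError_eq, norm_smul, Real.norm_of_nonneg (pow_nonneg ht.le ℓ)] at hmain
  rw [ArnoldiPhi.arnoldiResidual_eq ℓ hk hv hArnoldi ht, norm_neg, norm_smul, norm_mul, norm_norm,
    Real.norm_eq_abs, ArnoldiPhi.errorConst]
  have hc := abs_pos.2 hcorner
  -- Restoring $t^\ell$ turns $(t\varepsilon)^\ell$ into the $\varepsilon^\ell$ of the corner bound;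
  -- the corner entry cancels against the residual, and the two bounds coincide.
  rw [← mul_le_mul_iff_right₀ (pow_pos ht ℓ)]
  refine hmain.trans (le_of_eq ?_)
  rw [mul_pow]
  field_simp
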